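/- Let $K$ be a complete discrete valuation field of characteristic $0$ with valuation ring $\mathcal O_K$, normalized valuation $v_K$, maximal ideal $\mathfrak m_K$, and perfect residue field $k$ of characteristic $p>0$; fix a uniformizer $\pi$. All formal groups are commutative, one-dimensional and defined over $\mathcal O_K$. For a formal group $F$, let $F(K)$ be the set $\mathfrak m_K$ with the addition $x+y:=F(x,y)$, and for $m\ge 1$ let $F^m(K)\subset F(K)$ be the subgroup with underlying set $\mathfrak m_K^m$; define $F(\bar K)$ in the same way with the maximal ideal of $\mathcal O_{\bar K}$. A homomorphism $\phi:F\to G$ is a power series $\phi(T)=a_1T+a_2T^2+\cdots\in\mathcal O_K[[T]]$ with $\phi(F(X,Y))=G(\phi(X),\phi(Y))$; put $D(\phi):=a_1$. It is an isogeny of height $h\geq 1$ if $\phi(T)\equiv\psi(T^{p^h})\pmod{\mathfrak m_K}$ for some $\psi\in\mathcal O_K[[T]]$ with $v_K(D(\psi))=0$, where $D(\psi)$ is the coefficient of $T$ in $\psi$. Let $F[\phi]$ be the kernel of $F(\bar K)\to G(\bar K)$, let $G(\phi):=G(K)/\phi F(K)$, let $G^m(\phi)$ be the image of $G^m(K)$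 in $G(\phi)$, and let $\mathrm{gr}^m(\phi):=G^m(\phi)/G^{m+1}(\phi)$. Let $n\ge 1$ and let $\phi=\phi_1\circ\cdots\circ\phi_n:F\to G$ be an isogeny, where $F=G_n$, $G=G_0$ and each $\phi_i:G_i\to G_{i-1}$ is an isogeny of height $1$ (so $\phi$ has height $n$). Assume that $F[\phi]$ is cyclic and $F[\phi]\subset F(K)$. (Then necessarily $G_i=F/p^iF[\phi]$.) Put $t_0:=0$, $t_i:=v_K(D(\phi_i))$ for $1\le i\le n$, and $c_i(\phi):=t_0+t_1+\cdots+t_i+t_i/(p-1)$ for $0\le i\le n$. Below, $\simeq$ denotes isomorphism of abelian groups. (i) If $c_i(\phi)<m<c_{i+1}(\phi)$ for some $0\le i<n$, then $$\mathrm{gr}^m(\phi)\simeq \mathrm{gr}^{m-(t_1+\cdots+t_i)}(\phi_{i+1}\circ\cdots\circ\phi_n)\simeq\begin{cases}k,&p^{n-i}\nmid m,\\0,&p^{n-i}\mid m.\end{cases}$$ (ii) For $0\le i<n$, the numbers $c_{i+1}(\phi)$ and $pt_{i+1}/(p-1)$ are integers and $$\mathrm{gr}^{c_{i+1}(\phi)}(\phi)\simeq\mathrm{gr}^{pt_{i+1}/(p-1)}(\phi_{i+1}\circ\cdots\circ\phi_n)\simeq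 k/(a+\bar a_pC^{-1})k,$$ where $a\in k$ is the residue class of $D(\phi_{i+1})\pi^{-t_{i+1}}$, $\bar a_p\in k$ is the residue class of the coefficient of $T^p$ in $\phi_{i+1}$, and $a+\bar a_pC^{-1}:k\to k$ is the map $x\mapsto ax+\bar a_px^p$. If $k$ is separably closed, then $\mathrm{gr}^{c_{i+1}(\phi)}(\phi)=0$. If $k$ is quasi-finite (i.e. perfect with absolute Galois group isomorphic to $\widehat{\mathbb Z}$), then $\mathrm{gr}^{c_{i+1}(\phi)}(\phi)\simeq\mathbb Z/p\mathbb Z$. (iii) If $m>c_n(\phi)$, then $G^m(\phi)=0$; in particular $\mathrm{gr}^m(\phi)=0$. -/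

import Mathlib

open IsLocalRing

set_option linter.style.haveILetI false
set_option linter.unusedSectionVars false

noncomputable section

/-! ### Evaluation of power series on the maximal ideal of a complete local ring -/

section Evaluation

variable {O : Type*} [CommRing O] [IsLocalRing O]

/-- The value `f(a)` of a power series in several variables over a local ring `O`: the sum of the
series `∑ f_d a^d` for the `𝔪`-adic topology of `O`. -/
def mvEval {σ : Type*} (a : σ → O) (f : MvPowerSeries σ O) : O :=
  letI : TopologicalSpace O := (maximalIdeal O).adicTopology
  ∑' d : σ →₀ ℕ, MvPowerSeries.coeff d f * d.prod fun s e => a s ^ e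

/-- The value `f(x)` of a power series in one variable over a local ring `O`: the sum of the
series `∑ f_d x^d` for the `𝔪`-adic topology of `O`. -/
def psEval (x : O) (f : PowerSeries O) : O :=
  letI : TopologicalSpace O := (maximalIdeal O).adicTopology
  ∑' d : ℕ, PowerSeries.coeff d f * x ^ d

/-- Auxiliary: Mathlib's evaluation of power series, with discrete coefficients and values in
`O` with its `𝔪`-adic topology. -/
def mvEvalAux {σ : Type*} (a : σ → O) (f : MvPowerSeries σ O) : O :=
  letI : WithIdeal O := ⟨maximalIdeal O⟩
  @MvPowerSeries.eval₂ σ O _ ⊥ O _ _ (algebraMap O O) a f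

theorem adic_hasEval {σ : Type*} [Finite σ] {a : σ → O} (ha : ∀ s, a s ∈ maximalIdeal O) :
    letI : WithIdeal O := ⟨maximalIdeal O⟩
    MvPowerSeries.HasEval a := by
  letI : WithIdeal O := ⟨maximalIdeal O⟩
  exact ⟨fun s => WithIdeal.isTopologicallyNilpotent_of_mem (ha s), by simp⟩

variable [IsAdicComplete (maximalIdeal O) O]

theorem adic_complete_t2 :
    letI : WithIdeal O := ⟨maximalIdeal O⟩
    CompleteSpace O ∧ T2Space O := by
  letI : WithIdeal O := ⟨maximalIdeal O⟩
  exact (IsAdic.isAdicComplete_iff (I := maximalIdeal O) rfl).1 inferInstance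

theorem hasSum_mvEvalAux {σ : Type*} [Finite σ] {a : σ → O} (ha : ∀ s, a s ∈ maximalIdeal O)
    (f : MvPowerSeries σ O) :
    letI : TopologicalSpace O := (maximalIdeal O).adicTopology
    HasSum (fun d : σ →₀ ℕ => MvPowerSeries.coeff d f * d.prod fun s e => a s ^ e)
      (mvEvalAux a f) := by
  letI : WithIdeal O := ⟨maximalIdeal O⟩
  obtain ⟨h1, h2⟩ := adic_complete_t2 (O := O)
  have ht : @IsTopologicalSemiring O (⊥ : UniformSpace O).toTopologicalSpace _ := by
    letI : UniformSpace O := ⊥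
    infer_instance
  have hu : @IsUniformAddGroup O ⊥ _ := by
    letI : UniformSpace O := ⊥
    infer_instance
  exact @MvPowerSeries.hasSum_eval₂ σ O _ ⊥ O _ _ (algebraMap O O) a ht hu _ h1 h2 _ _
    continuous_bot (adic_hasEval ha) f

theorem hasSum_mvEval {σ : Type*} [Finite σ] {a : σ → O} (ha : ∀ s, a s ∈ maximalIdeal O)
    (f : MvPowerSeries σ O) :
    letI : TopologicalSpace O := (maximalIdeal O).adicTopology
    HasSum (fun d : σ →₀ ℕ => MvPowerSeries.coeff d f * d.prod fun s e => a s ^ e)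
      (mvEval a f) := by
  letI : WithIdeal O := ⟨maximalIdeal O⟩
  exact (hasSum_mvEvalAux ha f).summable.hasSum

theorem mvEval_eq_aux {σ : Type*} [Finite σ] {a : σ → O} (ha : ∀ s, a s ∈ maximalIdeal O)
    (f : MvPowerSeries σ O) : mvEval a f = mvEvalAux a f := by
  letI : WithIdeal O := ⟨maximalIdeal O⟩
  obtain ⟨h1, h2⟩ := adic_complete_t2 (O := O)
  exact (hasSum_mvEval ha f).unique (hasSum_mvEvalAux ha f)

theorem psEval_eq_mvEval {x : O} (hx : x ∈ maximalIdeal O) (f : PowerSeries O) :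
    psEval x f = mvEval (fun _ : Unit => x) f := by
  letI : WithIdeal O := ⟨maximalIdeal O⟩
  obtain ⟨h1, h2⟩ := adic_complete_t2 (O := O)
  have h := hasSum_mvEval (a := fun _ : Unit => x) (fun _ => hx) f
  rw [← (Finsupp.single_injective ()).hasSum_iff] at h
  · refine HasSum.tsum_eq ?_
    convert h using 2 with d
    simp [PowerSeries.coeff]
  · intro d hd
    exact False.elim (hd ⟨d (), by ext; simp⟩)

theorem isClosed_pow_maximalIdeal (N : ℕ) :
    letI : TopologicalSpace O := (maximalIdeal O).adicTopology
    IsClosed ((maximalIdeal O ^ N : Ideal O) : Set O) := by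
  letI : WithIdeal O := ⟨maximalIdeal O⟩
  exact (Ideal.openAddSubgroup (maximalIdeal O) N).isClosed

theorem hasSum_mem_pow {ι : Type*} {N : ℕ} {g : ι → O} {y : O}
    (h : letI : TopologicalSpace O := (maximalIdeal O).adicTopology; HasSum g y)
    (hg : ∀ i, g i ∈ maximalIdeal O ^ N) : y ∈ maximalIdeal O ^ N := by
  letI : WithIdeal O := ⟨maximalIdeal O⟩
  exact (isClosed_pow_maximalIdeal N).mem_of_tendsto h
    (Filter.Eventually.of_forall fun s => Ideal.sum_mem _ fun i _ => hg i)

theorem mvEval_mem {σ : Type*} [Finite σ] {a : σ → O} {N : ℕ} (hN : N ≠ 0)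
    (ha : ∀ s, a s ∈ maximalIdeal O ^ N)
    {f : MvPowerSeries σ O} (hf : MvPowerSeries.constantCoeff f = 0) :
    mvEval a f ∈ maximalIdeal O ^ N := by
  refine hasSum_mem_pow (hasSum_mvEval (fun s => Ideal.pow_le_self hN (ha s)) f) fun d => ?_
  by_cases hd : d = 0
  · subst hd
    have : MvPowerSeries.coeff 0 f = 0 := by simpa using hf
    simp [this]
  · obtain ⟨i, hi⟩ := Finsupp.support_nonempty_iff.mpr hd
    refine Ideal.mul_mem_left _ _ (Ideal.prod_mem _ hi ?_)
    exact Ideal.pow_mem_of_mem _ (ha i) _ (Nat.pos_of_ne_zero (Finsupp.mem_support_iff.mp hi))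

theorem psEval_mem {x : O} {N : ℕ} (hN : N ≠ 0) (hx : x ∈ maximalIdeal O ^ N)
    {f : PowerSeries O} (hf : PowerSeries.constantCoeff f = 0) :
    psEval x f ∈ maximalIdeal O ^ N := by
  rw [psEval_eq_mvEval (Ideal.pow_le_self hN hx)]
  exact mvEval_mem hN (fun _ => hx) hf

theorem mvEval_X {σ : Type*} [Finite σ] {a : σ → O} (ha : ∀ s, a s ∈ maximalIdeal O) (s : σ) :
    mvEval a (MvPowerSeries.X s) = a s := by
  rw [mvEval_eq_aux ha]
  letI : WithIdeal O := ⟨maximalIdeal O⟩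
  exact @MvPowerSeries.eval₂_X σ O _ ⊥ O _ _ _ a s

theorem mvEval_zero {σ : Type*} (a : σ → O) : mvEval a 0 = 0 := by
  simp [mvEval]

theorem mvEval_subst {σ τ : Type*} [Finite σ] [Finite τ] {a : σ → MvPowerSeries τ O} {b : τ → O}
    (ha : ∀ s, MvPowerSeries.constantCoeff (a s) = 0) (hb : ∀ t, b t ∈ maximalIdeal O)
    (f : MvPowerSeries σ O) :
    mvEval b (MvPowerSeries.subst a f) = mvEval (fun s => mvEval b (a s)) f := by
  have hab : ∀ s, mvEval b (a s) ∈ maximalIdeal O := fun s => by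
    have := mvEval_mem (N := 1) one_ne_zero (by simpa using hb) (ha s)
    simpa using this
  rw [mvEval_eq_aux hb, mvEval_eq_aux hab]
  simp_rw [mvEval_eq_aux hb]
  letI : WithIdeal O := ⟨maximalIdeal O⟩
  obtain ⟨h1, h2⟩ := adic_complete_t2 (O := O)
  have hdu : @DiscreteUniformity O ⊥ := @DiscreteUniformity.mk O ⊥ rfl
  exact @MvPowerSeries.eval₂_subst σ O _ τ O _ _ a O _ _ h2 h1 _ _ _ _ _ _ ⊥ hdu ⊥ hdu
    (MvPowerSeries.hasSubst_of_constantCoeff_zero ha) b (adic_hasEval hb) f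

end Evaluation

/-! ### Points of a formal group -/

namespace FormalGroup

section Points

variable {O : Type*} [CommRing O] [IsLocalRing O] [IsAdicComplete (maximalIdeal O) O]

/-- `F(K)`: the maximal ideal of `O = O_K`, to be equipped with the addition `x + y := F(x, y)`. -/
@[ext]
structure Points (F : FormalGroup O) where
  /-- The underlying element of `O`. -/
  val : O
  mem : val ∈ maximalIdeal O

theorem pair_mem {x y : O} {I : Ideal O} (hx : x ∈ I) (hy : y ∈ I) (s : Fin 2) : ![x, y] s ∈ I := by
  fin_cases s
  · exact hx
  · exact hy

theorem mvEval_pair_mem (F : FormalGroup O) {x y : O} {N : ℕ} (hN : N ≠ 0)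
    (hx : x ∈ maximalIdeal O ^ N) (hy : y ∈ maximalIdeal O ^ N) :
    mvEval ![x, y] F.toPowerSeries ∈ maximalIdeal O ^ N :=
  mvEval_mem hN (pair_mem hx hy) F.zero_constantCoeff

theorem mvEval_pair_mem_max (F : FormalGroup O) {x y : O}
    (hx : x ∈ maximalIdeal O) (hy : y ∈ maximalIdeal O) :
    mvEval ![x, y] F.toPowerSeries ∈ maximalIdeal O := by
  simpa using F.mvEval_pair_mem one_ne_zero (by simpa using hx) (by simpa using hy)

/-- Evaluation of `F(a, b)` for power series `a`, `b` without constant term. -/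
theorem mvEval_subst_pair {τ : Type*} [Finite τ] (f : MvPowerSeries (Fin 2) O)
    {a b : MvPowerSeries τ O} (ha : MvPowerSeries.constantCoeff a = 0)
    (hb : MvPowerSeries.constantCoeff b = 0) {c : τ → O} (hc : ∀ t, c t ∈ maximalIdeal O) :
    mvEval c (MvPowerSeries.subst ![a, b] f) = mvEval ![mvEval c a, mvEval c b] f := by
  rw [mvEval_subst _ hc]
  · congr 1
    funext s
    fin_cases s <;> rfl
  · intro s
    fin_cases s
    · exact ha
    · exact hb

instance (F : FormalGroup O) : Zero F.Points := ⟨⟨0, zero_mem _⟩⟩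

instance (F : FormalGroup O) : Add F.Points :=
  ⟨fun x y => ⟨mvEval ![x.val, y.val] F.toPowerSeries, F.mvEval_pair_mem_max x.mem y.mem⟩⟩

theorem Points.val_zero (F : FormalGroup O) : (0 : F.Points).val = 0 := rfl

theorem Points.val_add {F : FormalGroup O} (x y : F.Points) :
    (x + y).val = mvEval ![x.val, y.val] F.toPowerSeries := rfl

theorem constantCoeff_subst_pair_X (F : FormalGroup O) {τ : Type*} (i j : τ) :
    MvPowerSeries.constantCoeff
      (MvPowerSeries.subst ![(MvPowerSeries.X i : MvPowerSeries τ O), MvPowerSeries.X j]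
        F.toPowerSeries) = 0 :=
  MvPowerSeries.constantCoeff_subst_eq_zero MvPowerSeries.HasSubst.X_X
    (fun s => by fin_cases s <;> simp) F.zero_constantCoeff

theorem Points.add_assoc' {F : FormalGroup O} (x y z : F.Points) : x + y + z = x + (y + z) := by
  have hc : ∀ t, ![x.val, y.val, z.val] t ∈ maximalIdeal O := fun t => by
    fin_cases t
    · exact x.mem
    · exact y.mem
    · exact z.mem
  have h := congrArg (mvEval ![x.val, y.val, z.val]) F.assoc
  rw [mvEval_subst_pair _ (F.constantCoeff_subst_pair_X _ _) (MvPowerSeries.constantCoeff_X _) hc,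
    mvEval_subst_pair _ (MvPowerSeries.constantCoeff_X _) (F.constantCoeff_subst_pair_X _ _) hc,
    mvEval_subst_pair _ (MvPowerSeries.constantCoeff_X _) (MvPowerSeries.constantCoeff_X _) hc,
    mvEval_subst_pair _ (MvPowerSeries.constantCoeff_X _) (MvPowerSeries.constantCoeff_X _) hc,
    mvEval_X hc, mvEval_X hc, mvEval_X hc] at h
  exact Points.ext h

theorem mvEval_right_zero (F : FormalGroup O) {x : O} (hx : x ∈ maximalIdeal O) :
    mvEval ![x, 0] F.toPowerSeries = x := by
  have hc : ∀ _ : Unit, x ∈ maximalIdeal O := fun _ => hx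
  have h := congrArg (mvEval fun _ : Unit => x) F.Xzero_eq_X
  rw [Xzero, PowerSeries.X,
    mvEval_subst_pair _ (MvPowerSeries.constantCoeff_X _) (map_zero _) hc,
    mvEval_X hc, mvEval_zero] at h
  exact h

theorem Points.add_zero' {F : FormalGroup O} (x : F.Points) : x + 0 = x :=
  Points.ext (F.mvEval_right_zero x.mem)

theorem Points.add_comm' {F : FormalGroup O} [F.IsComm] (x y : F.Points) : x + y = y + x := by
  have hc := pair_mem x.mem y.mem
  have h := congrArg (mvEval ![x.val, y.val]) (IsComm.comm (F := F))
  rw [mvEval_subst_pair _ (MvPowerSeries.constantCoeff_X _) (MvPowerSeries.constantCoeff_X _) hc,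
    mvEval_X hc, mvEval_X hc] at h
  exact Points.ext h

theorem mvEval_sub_mem (F : FormalGroup O) {x y y' : O} {N : ℕ} (hx : x ∈ maximalIdeal O)
    (hy : y ∈ maximalIdeal O) (hy' : y' ∈ maximalIdeal O) (h : y - y' ∈ maximalIdeal O ^ N) :
    mvEval ![x, y] F.toPowerSeries - mvEval ![x, y'] F.toPowerSeries - (y - y') ∈
      maximalIdeal O ^ (N + 1) := by
  classical
  letI : WithIdeal O := ⟨maximalIdeal O⟩
  have h1 := hasSum_mvEval (pair_mem hx hy) F.toPowerSeries
  have h2 := hasSum_mvEval (pair_mem hx hy') F.toPowerSeries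
  have h3 : HasSum (fun d : Fin 2 →₀ ℕ => if d = Finsupp.single 1 1 then y - y' else 0) (y - y') :=
    hasSum_ite_eq _ _
  refine hasSum_mem_pow ((h1.sub h2).sub h3) fun d => ?_
  have hprod : ∀ z : O, (d.prod fun s e => ![x, z] s ^ e) = x ^ d 0 * z ^ d 1 := fun z => by
    rw [Finsupp.prod_fintype _ _ (fun _ => pow_zero _), Fin.prod_univ_two]
    rfl
  obtain ⟨q, hq⟩ := sub_dvd_pow_sub_pow y y' (d 1)
  by_cases hd : d = Finsupp.single 1 1
  · subst hd
    simp [F.lin_coeff_Y, Finsupp.prod_single_index]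
  · simp only [hprod, if_neg hd, sub_zero, ← mul_sub]
    refine Ideal.mul_mem_left _ _ ?_
    by_cases h0 : d 0 = 0
    · rw [h0, pow_zero, one_mul]
      by_cases h10 : d 1 = 0
      · simp [h10]
      have h11 : d 1 ≠ 1 := fun h11 => hd (by
        ext s
        fin_cases s
        · simpa using h0
        · simpa using h11)
      rw [← geom_sum₂_mul, pow_succ']
      refine Ideal.mul_mem_mul (Ideal.sum_mem _ fun i hi => ?_) h
      by_cases hi0 : i = 0
      · exact Ideal.mul_mem_left _ _ (Ideal.pow_mem_of_mem _ hy' _ (by omega))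
      · exact Ideal.mul_mem_right _ _ (Ideal.pow_mem_of_mem _ hy _ (by omega))
    · rw [pow_succ']
      refine Ideal.mul_mem_mul (Ideal.pow_mem_of_mem _ hx _ (Nat.pos_of_ne_zero h0)) ?_
      rw [hq]
      exact Ideal.mul_mem_right _ _ h

theorem exists_right_neg (F : FormalGroup O) {x : O} (hx : x ∈ maximalIdeal O) :
    ∃ y ∈ maximalIdeal O, mvEval ![x, y] F.toPowerSeries = 0 := by
  let u : ℕ → O := fun k => Nat.rec 0 (fun _ y => y - mvEval ![x, y] F.toPowerSeries) k
  have hu : ∀ k, u (k + 1) = u k - mvEval ![x, u k] F.toPowerSeries := fun k => rfl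
  have hm : ∀ k, u k ∈ maximalIdeal O := fun k => by
    induction k with
    | zero => exact zero_mem _
    | succ k ih => rw [hu]; exact sub_mem ih (F.mvEval_pair_mem_max hx ih)
  have hF : ∀ k, mvEval ![x, u k] F.toPowerSeries ∈ maximalIdeal O ^ (k + 1) := fun k => by
    induction k with
    | zero => simpa using F.mvEval_pair_mem_max hx (hm 0)
    | succ k ih =>
      have h := F.mvEval_sub_mem (N := k + 1) hx (hm (k + 1)) (hm k)
        (by rw [hu]; simpa using ih)
      have e : u (k + 1) - u k = - mvEval ![x, u k] F.toPowerSeries := by rw [hu]; ring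
      rw [e] at h
      simpa using h
  have hstep : ∀ k, u k - u (k + 1) ∈ maximalIdeal O ^ k := fun k => by
    rw [hu, sub_sub_cancel]
    exact Ideal.pow_le_pow_right (Nat.le_succ k) (hF k)
  have hcau : ∀ {m n : ℕ}, m ≤ n → u m ≡ u n [SMOD (maximalIdeal O ^ m • ⊤ : Submodule O O)] := by
    intro m n hmn
    rw [SModEq.sub_mem, smul_eq_mul, Ideal.mul_top]
    induction n, hmn using Nat.le_induction with
    | base => simp
    | succ n hmn ih =>
      have := Ideal.add_mem _ ih (Ideal.pow_le_pow_right hmn (hstep n))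
      simpa using this
  obtain ⟨y, hy⟩ := IsPrecomplete.prec (I := maximalIdeal O) inferInstance hcau
  simp only [SModEq.sub_mem, smul_eq_mul, Ideal.mul_top] at hy
  have hym : y ∈ maximalIdeal O := by
    have := sub_mem (hm 1) (by simpa using hy 1)
    simpa using this
  refine ⟨y, hym, IsHausdorff.haus (I := maximalIdeal O) inferInstance _ fun k => ?_⟩
  rw [SModEq.sub_mem, smul_eq_mul, Ideal.mul_top, sub_zero]
  have h1 := Ideal.pow_le_pow_right (Nat.le_succ k) (F.mvEval_sub_mem hx (hm k) hym (hy k))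
  have h2 := Ideal.pow_le_pow_right (Nat.le_succ k) (hF k)
  have h3 := sub_mem (sub_mem h2 h1) (hy k)
  convert h3 using 1
  ring

instance (F : FormalGroup O) : Neg F.Points :=
  ⟨fun x => ⟨(F.exists_right_neg x.mem).choose, (F.exists_right_neg x.mem).choose_spec.1⟩⟩

theorem Points.add_neg' {F : FormalGroup O} (x : F.Points) : x + -x = 0 :=
  Points.ext (F.exists_right_neg x.mem).choose_spec.2

/-- The group `F(K)`, for a commutative formal group `F` over `O = O_K`. -/
instance (F : FormalGroup O) [F.IsComm] : AddCommGroup F.Points where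
  add_assoc := Points.add_assoc'
  zero_add x := by rw [Points.add_comm', Points.add_zero']
  add_zero := Points.add_zero'
  neg_add_cancel x := by rw [Points.add_comm', Points.add_neg']
  add_comm := Points.add_comm'
  nsmul := nsmulRec
  zsmul := zsmulRec

theorem neg_mem_pow {F : FormalGroup O} {N : ℕ} (x : F.Points)
    (hx : x.val ∈ maximalIdeal O ^ N) : (-x).val ∈ maximalIdeal O ^ N := by
  suffices h : ∀ k ≤ N, (-x).val ∈ maximalIdeal O ^ k from h N le_rfl
  intro k
  induction k with
  | zero => simp
  | succ k ih =>
    intro hk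
    have h := F.mvEval_sub_mem (N := k) x.mem (-x).mem (zero_mem _) (by simpa using ih (by omega))
    have h0 : mvEval ![x.val, (-x).val] F.toPowerSeries = 0 := congrArg Points.val (Points.add_neg' x)
    rw [h0, F.mvEval_right_zero x.mem] at h
    have := neg_mem (add_mem h (Ideal.pow_le_pow_right hk hx))
    simpa using this

/-- `F^m(K)`: the subgroup of `F(K)` consisting of the set `𝔪^m`. -/
def fil (F : FormalGroup O) [F.IsComm] (m : ℕ) : AddSubgroup F.Points where
  carrier := {x | x.val ∈ maximalIdeal O ^ m}
  zero_mem' := zero_mem (maximalIdeal O ^ m)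
  add_mem' {x y} hx hy := by
    rcases Nat.eq_zero_or_pos m with rfl | hm
    · simp
    · exact F.mvEval_pair_mem hm.ne' hx hy
  neg_mem' {x} hx := neg_mem_pow x hx

end Points

/-! ### Homomorphisms of formal groups -/

section Hom

/-- A homomorphism `F → G` of formal groups over `R`: a power series `φ(T)` without constant term
such that `φ(F(X, Y)) = G(φ(X), φ(Y))`. -/
@[ext]
structure Hom {R : Type*} [CommRing R] (F G : FormalGroup R) where
  /-- The underlying power series `φ(T)`. -/
  series : PowerSeries R
  constantCoeff_series : PowerSeries.constantCoeff series = 0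
  map_add' : PowerSeries.subst F.toPowerSeries series =
    MvPowerSeries.subst ![PowerSeries.subst (MvPowerSeries.X (0 : Fin 2) : MvPowerSeries (Fin 2) R)
        series,
      PowerSeries.subst (MvPowerSeries.X (1 : Fin 2) : MvPowerSeries (Fin 2) R) series]
      G.toPowerSeries

namespace Hom

variable {R : Type*} [CommRing R] {F G H : FormalGroup R}

theorem subst_psSubst {σ τ : Type*} {a : MvPowerSeries σ R} {b : σ → MvPowerSeries τ R}
    (ha : PowerSeries.HasSubst a) (hb : MvPowerSeries.HasSubst b) (f : PowerSeries R) :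
    MvPowerSeries.subst b (PowerSeries.subst a f) =
      PowerSeries.subst (MvPowerSeries.subst b a) f :=
  MvPowerSeries.subst_comp_subst_apply ha.const hb f

/-- The identity homomorphism `T`. -/
protected def id (F : FormalGroup R) : Hom F F where
  series := PowerSeries.X
  constantCoeff_series := by simp
  map_add' := by
    rw [PowerSeries.subst_X (.of_constantCoeff_zero F.zero_constantCoeff),
      PowerSeries.subst_X (.X _), PowerSeries.subst_X (.X _)]
    have : (![MvPowerSeries.X 0, MvPowerSeries.X 1] : Fin 2 → MvPowerSeries (Fin 2) R) =
        MvPowerSeries.X := by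
      funext s
      fin_cases s <;> rfl
    rw [this, ← MvPowerSeries.map_algebraMap_eq_subst_X]
    simp

/-- The composite `φ ∘ ψ`, with power series `φ(ψ(T))`. -/
def comp (φ : Hom G H) (ψ : Hom F G) : Hom F H where
  series := PowerSeries.subst ψ.series φ.series
  constantCoeff_series :=
    PowerSeries.constantCoeff_subst_eq_zero ψ.constantCoeff_series _ φ.constantCoeff_series
  map_add' := by
    have hψ : PowerSeries.HasSubst ψ.series := .of_constantCoeff_zero' ψ.constantCoeff_series
    have hF : PowerSeries.HasSubst F.toPowerSeries := .of_constantCoeff_zero F.zero_constantCoeff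
    have hG : PowerSeries.HasSubst G.toPowerSeries := .of_constantCoeff_zero G.zero_constantCoeff
    have hz : ∀ i : Fin 2, MvPowerSeries.constantCoeff (PowerSeries.subst
        (MvPowerSeries.X i : MvPowerSeries (Fin 2) R) ψ.series) = 0 := fun i =>
      PowerSeries.constantCoeff_subst_eq_zero (by simp) _ ψ.constantCoeff_series
    have hz' : ∀ i : Fin 2, MvPowerSeries.constantCoeff (PowerSeries.subst
        (MvPowerSeries.X i : MvPowerSeries (Fin 2) R) φ.series) = 0 := fun i =>
      PowerSeries.constantCoeff_subst_eq_zero (by simp) _ φ.constantCoeff_series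
    have hp : MvPowerSeries.HasSubst
        ![PowerSeries.subst (MvPowerSeries.X (0 : Fin 2) : MvPowerSeries (Fin 2) R) ψ.series,
          PowerSeries.subst (MvPowerSeries.X (1 : Fin 2) : MvPowerSeries (Fin 2) R) ψ.series] :=
      MvPowerSeries.hasSubst_of_constantCoeff_zero fun s => by
        fin_cases s
        · exact hz 0
        · exact hz 1
    have hp' : MvPowerSeries.HasSubst
        ![PowerSeries.subst (MvPowerSeries.X (0 : Fin 2) : MvPowerSeries (Fin 2) R) φ.series,
          PowerSeries.subst (MvPowerSeries.X (1 : Fin 2) : MvPowerSeries (Fin 2) R) φ.series] :=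
      MvPowerSeries.hasSubst_of_constantCoeff_zero fun s => by
        fin_cases s
        · exact hz' 0
        · exact hz' 1
    rw [PowerSeries.subst_comp_subst_apply hψ hF, ψ.map_add']
    have e := congrArg (MvPowerSeries.subst
      ![PowerSeries.subst (MvPowerSeries.X (0 : Fin 2) : MvPowerSeries (Fin 2) R) ψ.series,
        PowerSeries.subst (MvPowerSeries.X (1 : Fin 2) : MvPowerSeries (Fin 2) R) ψ.series])
      φ.map_add'
    rw [subst_psSubst hG hp,
      MvPowerSeries.subst_comp_subst_apply hp' hp] at e
    refine e.trans ?_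
    congr 1
    funext s
    have key : ∀ i : Fin 2, MvPowerSeries.subst
        ![PowerSeries.subst (MvPowerSeries.X (0 : Fin 2) : MvPowerSeries (Fin 2) R) ψ.series,
          PowerSeries.subst (MvPowerSeries.X (1 : Fin 2) : MvPowerSeries (Fin 2) R) ψ.series]
        (PowerSeries.subst (MvPowerSeries.X i : MvPowerSeries (Fin 2) R) φ.series) =
        PowerSeries.subst (MvPowerSeries.X i : MvPowerSeries (Fin 2) R)
          (PowerSeries.subst ψ.series φ.series) := fun i => by
      rw [PowerSeries.subst_comp_subst_apply hψ (.X i), subst_psSubst (.X i) hp,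
        MvPowerSeries.subst_X hp]
      fin_cases i <;> rfl
    fin_cases s
    · exact key 0
    · exact key 1

variable {O : Type*} [CommRing O] [IsLocalRing O] [IsAdicComplete (maximalIdeal O) O]
variable {F G : FormalGroup O}

/-- The homomorphism `F(K) → G(K)`, `x ↦ φ(x)`, induced by `φ : F → G`. -/
def onPoints [F.IsComm] [G.IsComm] (φ : Hom F G) : F.Points →+ G.Points :=
  AddMonoidHom.mk'
    (fun x => ⟨psEval x.val φ.series, by
      simpa using psEval_mem one_ne_zero (by simpa using x.mem) φ.constantCoeff_series⟩)
    (fun x y => by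
      have hc := pair_mem x.mem y.mem
      have hz : ∀ i : Fin 2, MvPowerSeries.constantCoeff (PowerSeries.subst
          (MvPowerSeries.X i : MvPowerSeries (Fin 2) O) φ.series) = 0 := fun i =>
        PowerSeries.constantCoeff_subst_eq_zero (by simp) _ φ.constantCoeff_series
      have h := congrArg (mvEval ![x.val, y.val]) φ.map_add'
      rw [mvEval_subst_pair _ (hz 0) (hz 1) hc, PowerSeries.subst, PowerSeries.subst,
        PowerSeries.subst, mvEval_subst (fun _ => F.zero_constantCoeff) hc,
        mvEval_subst (fun _ => MvPowerSeries.constantCoeff_X _) hc,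
        mvEval_subst (fun _ => MvPowerSeries.constantCoeff_X _) hc] at h
      simp only [mvEval_X hc] at h
      refine Points.ext ?_
      simp only [Points.val_add]
      rw [psEval_eq_mvEval x.mem, psEval_eq_mvEval y.mem,
        psEval_eq_mvEval (F.mvEval_pair_mem_max x.mem y.mem)]
      exact h)

/-- `G(φ) := G(K) / φ F(K)`. -/
abbrev Coker [F.IsComm] [G.IsComm] (φ : Hom F G) : Type _ := G.Points ⧸ φ.onPoints.range

/-- `G^m(φ)`: the image of `G^m(K)` in `G(φ)`. -/
def cokerFil [F.IsComm] [G.IsComm] (φ : Hom F G) (m : ℕ) : AddSubgroup φ.Coker :=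
  (G.fil m).map (QuotientAddGroup.mk' φ.onPoints.range)

/-- `gr^m(φ) := G^m(φ) / G^{m+1}(φ)`. -/
abbrev gr [F.IsComm] [G.IsComm] (φ : Hom F G) (m : ℕ) : Type _ :=
  φ.cokerFil m ⧸ (φ.cokerFil (m + 1)).addSubgroupOf (φ.cokerFil m)

/-- `φ` has height `n`: there is a power series `ψ` whose linear coefficient is a unit such that
`φ(T) ≡ ψ(T^{p^n})` modulo the maximal ideal. -/
def HasHeight (φ : Hom F G) (p n : ℕ) : Prop :=
  ∃ ψ : PowerSeries O, IsUnit (PowerSeries.coeff 1 ψ) ∧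
    PowerSeries.map (residue O) φ.series =
      PowerSeries.map (residue O) (PowerSeries.subst (PowerSeries.X ^ p ^ n : PowerSeries O) ψ)

/-- `D(φ)`: the coefficient of `T` in `φ(T)`. -/
def linCoeff (φ : Hom F G) : O := PowerSeries.coeff 1 φ.series

/-- The kernel of the map `F(K̄) → G(K̄)` induced by `φ`: the elements `x` of the maximal ideal of
the valuation ring `O_K̄` such that `φ(x) = 0`. Here `O_K̄` is the integral closure of `O` in an
algebraic closure `K̄` of `K = Frac O` (for complete `O` it is the valuation ring of the unique
valuation of `K̄` extending that of `K`), its topology is given by the ideals `𝔪_K^N O_K̄`, and its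
maximal ideal is the set of nonunits. -/
def geomKernel (K : Type*) [Field K] [Algebra O K] (φ : Hom F G) :
    Set (integralClosure O (AlgebraicClosure K)) :=
  {x | x ∈ nonunits (integralClosure O (AlgebraicClosure K)) ∧
    letI : TopologicalSpace (integralClosure O (AlgebraicClosure K)) :=
      ((maximalIdeal O).map
        (algebraMap O (integralClosure O (AlgebraicClosure K)))).adicTopology
    HasSum (fun d : ℕ => PowerSeries.coeff d φ.series • x ^ d) 0}

/-- `F[φ] ⊆ F(K)`: every element of the kernel of `F(K̄) → G(K̄)` comes from `F(K) = 𝔪_K`. -/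
def KernelRational (K : Type*) [Field K] [Algebra O K] (φ : Hom F G) : Prop :=
  ∀ x ∈ φ.geomKernel K, ∃ y ∈ maximalIdeal O,
    algebraMap O (integralClosure O (AlgebraicClosure K)) y = x

end Hom

end Hom

/-! ### Chains of isogenies `G_n → ⋯ → G_1 → G_0` -/

section Chain

/-- For `φ_{i+1} = φ i : G_{i+1} → G_i` with `0 ≤ i < n`, the composite
`φ_{i+1} ∘ ⋯ ∘ φ_n : G_n → G_i`. -/
def chainComp {R : Type*} [CommRing R] {n : ℕ} {G : Fin (n + 1) → FormalGroup R}
    (φ : ∀ i : Fin n, Hom (G i.succ) (G i.castSucc)) (i : Fin (n + 1)) :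
    Hom (G (Fin.last n)) (G i) :=
  Fin.reverseInduction (motive := fun i => Hom (G (Fin.last n)) (G i)) (Hom.id _)
    (fun i f => (φ i).comp f) i

variable {O : Type*} [CommRing O] [IsDomain O] [IsDiscreteValuationRing O]

/-- `t_{i+1} := v_K(D(φ_{i+1}))`, where `φ_{i+1} = φ i`. -/
def chainT {n : ℕ} {G : Fin (n + 1) → FormalGroup O}
    (φ : ∀ i : Fin n, Hom (G i.succ) (G i.castSucc)) (i : Fin n) : ℕ :=
  (IsDiscreteValuationRing.addVal O (φ i).linCoeff).toNat

/-- `c_0 = 0` and `c_{i+1} = t_1 + ⋯ + t_{i+1} + t_{i+1} / (p - 1)`. -/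
def chainC (p : ℕ) {n : ℕ} {G : Fin (n + 1) → FormalGroup O}
    (φ : ∀ i : Fin n, Hom (G i.succ) (G i.castSucc)) (i : Fin (n + 1)) : ℚ :=
  Fin.cases 0
    (fun j => (∑ l ∈ Finset.Iic j, (chainT φ l : ℚ)) + (chainT φ j : ℚ) / ((p : ℚ) - 1)) i

end Chain

end FormalGroup

/-- The additive map `a + b C⁻¹ : x ↦ a x + b x ^ p` of a field `k` of characteristic `p`. -/
def addCartierInv {k : Type*} [Field k] (p : ℕ) [Fact p.Prime] [CharP k p] (a b : k) : k →+ k :=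
  AddMonoidHom.mulLeft a + (AddMonoidHom.mulLeft b).comp (frobenius k p).toAddMonoidHom

/-- A field is quasi-finite if it is perfect and its absolute Galois group is isomorphic, as a
topological group, to the profinite completion of `ℤ`. -/
def IsQuasiFiniteField (k : Type*) [Field k] : Prop :=
  PerfectField k ∧ Nonempty (Field.absoluteGaloisGroup k ≃ₜ*
    ProfiniteGrp.ProfiniteCompletion.completion (GrpCat.of (Multiplicative ℤ)))

end

/-! Write `s_i = t_i/(p-1)`. Since `φ_i` has height one, Weierstrass preparation makes it a unit
times a distinguished polynomial of degree `p`; when its `p` zeros are rational, that polynomial is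
`∏ (T - w)` over the kernel. The kernel has prime order and the filtration is by subgroups, so all
nonzero zeros have one valuation, which must be `s_i`. Hence leading terms are explicit: with `a`
the unit part of `D(φ_i)` and `b` the coefficient of `T^p`, a point `π^j ξ` goes to leading term `b
ξ^p` in degree `p j` if `j < s_i`, to `a ξ + b ξ^p` in degree `p s_i` if `j = s_i`, and to `a ξ` in
degree `j + t_i` if `j > s_i` (`exists_profile`).

The graded piece in degree `m` is `k` modulo the group of degree `m` leading coefficients of the
image (`nonempty_gr_equiv`), so it suffices to follow these groups through `φ_i ∘ ψ`. Below degree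
`p s_i` they are Frobenius twists of those of `ψ` in degree divided by `p`; at `p s_i` the map `a +
b C⁻¹` is applied; above, they are shifted by `t_i`, provided that `ker φ_i` lies in the image of
`ψ` (`leadGroup_low`, `leadGroup_mid`, `leadGroup_high`).

Rationality supplies the kernels: in characteristic zero the zeros of an isogeny are simple, so the
composite has exactly `p^n` rational zeros (`card_ker_of_kernelRational`). As each factor has at
most `p`, every bound is attained and each `ker φ_i` lies in the image of the later isogenies.

Cyclicity gives `s_i < p s_{i+1}` (`lt_mul_of_succ_eq_castSucc`): a nonzero point of `ker φ_i` is
the image of a point whose `p`-multiple is nonzero in `ker φ_{i+1}`, and multiplication by `p`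
raises valuations. So the breaks increase, and between two of them only Frobenius twists occur: the
leading group of `φ_{i+1} ∘ ⋯ ∘ φ_n` in degree `r < p s_{i+1}` is `k` or `0` according to whether
`p^{n-i}` divides `r` (`leadGroup_of_lt`). As `ker φ_i` lies in that image, `p^{n-i}` divides `s_i`,
so the shifts `t_1, …, t_i` do not affect divisibility. At a break the cokernel of `a + b C⁻¹` is
computed by Artin–Schreier theory. -/

noncomputable section

/-! ### Evaluation of power series at points of the maximal ideal -/

section Evaluation

variable {O : Type*} [CommRing O] [IsLocalRing O] [IsAdicComplete (maximalIdeal O) O]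

/-- Evaluation of power series at a point of the maximal ideal, as a ring homomorphism. -/
def psEvalHom {x : O} (hx : x ∈ maximalIdeal O) : PowerSeries O →+* O :=
  letI : WithIdeal O := ⟨maximalIdeal O⟩
  haveI ht : @IsTopologicalSemiring O (⊥ : UniformSpace O).toTopologicalSpace _ := by
    letI : UniformSpace O := ⊥
    infer_instance
  haveI hu : @IsUniformAddGroup O ⊥ _ := by
    letI : UniformSpace O := ⊥
    infer_instance
  @MvPowerSeries.eval₂Hom Unit O _ ⊥ O _ _ (algebraMap O O) (fun _ => x) ht hu _
    (adic_complete_t2 (O := O)).1 (adic_complete_t2 (O := O)).2 _ _ continuous_bot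
    (adic_hasEval fun _ => hx)

theorem psEvalHom_apply {x : O} (hx : x ∈ maximalIdeal O) (f : PowerSeries O) :
    psEvalHom hx f = psEval x f := by
  rw [psEval_eq_mvEval hx, mvEval_eq_aux fun _ => hx]
  letI : WithIdeal O := ⟨maximalIdeal O⟩
  have ht : @IsTopologicalSemiring O (⊥ : UniformSpace O).toTopologicalSpace _ := by
    letI : UniformSpace O := ⊥
    infer_instance
  have hu : @IsUniformAddGroup O ⊥ _ := by
    letI : UniformSpace O := ⊥
    infer_instance
  exact congrFun (@MvPowerSeries.coe_eval₂Hom Unit O _ ⊥ O _ _ (algebraMap O O) (fun _ => x) ht hu _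
    (adic_complete_t2 (O := O)).1 (adic_complete_t2 (O := O)).2 _ _ continuous_bot
    (adic_hasEval fun _ => hx)) f

theorem psEval_mul {x : O} (hx : x ∈ maximalIdeal O) (f g : PowerSeries O) :
    psEval x (f * g) = psEval x f * psEval x g := by
  simp only [← psEvalHom_apply hx, map_mul]

theorem psEval_X {x : O} (hx : x ∈ maximalIdeal O) : psEval x (PowerSeries.X : PowerSeries O) = x := by
  rw [psEval_eq_mvEval hx]
  exact mvEval_X (fun _ => hx) ()

theorem psEval_C (x c : O) : psEval x (PowerSeries.C c) = c := by
  letI : WithIdeal O := ⟨maximalIdeal O⟩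
  obtain ⟨h1, h2⟩ := adic_complete_t2 (O := O)
  rw [psEval, tsum_eq_single 0]
  · simp
  · intro d hd
    simp [PowerSeries.coeff_C, hd]

theorem psEval_coe {x : O} (hx : x ∈ maximalIdeal O) (P : Polynomial O) :
    psEval x (P : PowerSeries O) = P.eval x := by
  have : (psEvalHom hx).comp (Polynomial.coeToPowerSeries.ringHom) = Polynomial.evalRingHom x := by
    refine Polynomial.ringHom_ext (fun a => ?_) ?_
    · simp [psEvalHom_apply, psEval_C]
    · simp [psEvalHom_apply, psEval_X hx]
  simpa [psEvalHom_apply] using RingHom.congr_fun this P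

/-- Splitting off the constant term. -/
theorem psEval_eq_add_mul {x : O} (hx : x ∈ maximalIdeal O) (f : PowerSeries O) :
    psEval x f = PowerSeries.constantCoeff f +
      x * psEval x (PowerSeries.mk fun i => PowerSeries.coeff (i + 1) f) := by
  conv_lhs => rw [PowerSeries.eq_X_mul_shift_add_const f]
  rw [← psEvalHom_apply hx, map_add, map_mul, psEvalHom_apply, psEvalHom_apply, psEvalHom_apply,
    psEval_X hx, psEval_C, add_comm]

theorem dvd_psEval_sub_constantCoeff {x : O} (hx : x ∈ maximalIdeal O) (f : PowerSeries O) :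
    x ∣ psEval x f - PowerSeries.constantCoeff f :=
  ⟨_, by rw [psEval_eq_add_mul hx, add_sub_cancel_left]⟩

theorem psEval_subst {x : O} (hx : x ∈ maximalIdeal O) {g : PowerSeries O}
    (hg : PowerSeries.constantCoeff g = 0) (f : PowerSeries O) :
    psEval x (PowerSeries.subst g f) = psEval (psEval x g) f := by
  have hgx : psEval x g ∈ maximalIdeal O := by
    simpa using psEval_mem one_ne_zero (by simpa using hx) hg
  rw [psEval_eq_mvEval hx, psEval_eq_mvEval hgx, psEval_eq_mvEval hx, PowerSeries.subst]
  exact mvEval_subst (fun _ => hg) (fun _ => hx) f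

end Evaluation

/-! ### The filtration on points and successive approximation -/

namespace FormalGroup

variable {O : Type*} [CommRing O] [IsLocalRing O] [IsAdicComplete (maximalIdeal O) O]

/-- `F(x, y) ≡ x + y` modulo terms of degree at least two. -/
theorem mvEval_pair_sub_add_mem (F : FormalGroup O) {x y : O} {N : ℕ} (hN : N ≠ 0)
    (hx : x ∈ maximalIdeal O ^ N) (hy : y ∈ maximalIdeal O ^ N) :
    mvEval ![x, y] F.toPowerSeries - (x + y) ∈ maximalIdeal O ^ (2 * N) := by
  classical
  letI : WithIdeal O := ⟨maximalIdeal O⟩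
  have h1 := hasSum_mvEval (pair_mem (Ideal.pow_le_self hN hx) (Ideal.pow_le_self hN hy))
    F.toPowerSeries
  have h2 : HasSum (fun d : Fin 2 →₀ ℕ => if d = Finsupp.single 0 1 then x else 0) x :=
    hasSum_ite_eq _ _
  have h3 : HasSum (fun d : Fin 2 →₀ ℕ => if d = Finsupp.single 1 1 then y else 0) y :=
    hasSum_ite_eq _ _
  refine hasSum_mem_pow (h1.sub (h2.add h3)) fun d => ?_
  have hne : (Finsupp.single 0 1 : Fin 2 →₀ ℕ) ≠ Finsupp.single 1 1 := fun h => by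
    simpa using DFunLike.congr_fun h 0
  by_cases hd0 : d = Finsupp.single 0 1
  · subst hd0
    simp [F.lin_coeff_X, Finsupp.prod_single_index, hne]
  by_cases hd1 : d = Finsupp.single 1 1
  · subst hd1
    simp [F.lin_coeff_Y, Finsupp.prod_single_index, hne.symm]
  rw [if_neg hd0, if_neg hd1, _root_.add_zero, sub_zero]
  by_cases hz : d = 0
  · subst hz
    have : MvPowerSeries.coeff 0 F.toPowerSeries = 0 := by simpa using F.zero_constantCoeff
    simp [this]
  have hprod : (d.prod fun s e => ![x, y] s ^ e) = x ^ d 0 * y ^ d 1 := by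
    rw [Finsupp.prod_fintype _ _ (fun _ => pow_zero _), Fin.prod_univ_two]
    rfl
  have hdeg : 2 ≤ d 0 + d 1 := by
    by_contra! hlt
    rcases Nat.eq_zero_or_pos (d 0) with h0 | h0
    · rcases Nat.eq_zero_or_pos (d 1) with h1 | h1
      · exact hz (by ext s; fin_cases s <;> simpa)
      · refine hd1 (by ext s; fin_cases s <;> simp <;> omega)
    · refine hd0 (by ext s; fin_cases s <;> simp <;> omega)
  rw [hprod]
  refine Ideal.mul_mem_left _ _ (Ideal.pow_le_pow_right (Nat.mul_le_mul_right N hdeg) ?_)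
  rw [add_mul, pow_add, mul_comm (d 0), mul_comm (d 1), pow_mul, pow_mul]
  exact Ideal.mul_mem_mul (Ideal.pow_mem_pow hx _) (Ideal.pow_mem_pow hy _)

/-- `F(x, y) ≡ x + y` modulo `𝔪 ^ (N + 1)` for `y ∈ 𝔪 ^ N`. -/
theorem mvEval_pair_sub_add_mem_succ (F : FormalGroup O) {x y : O} {N : ℕ}
    (hx : x ∈ maximalIdeal O) (hy : y ∈ maximalIdeal O) (hyN : y ∈ maximalIdeal O ^ N) :
    mvEval ![x, y] F.toPowerSeries - (x + y) ∈ maximalIdeal O ^ (N + 1) := by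
  have h := F.mvEval_sub_mem hx hy (zero_mem _) (by simpa using hyN)
  rw [F.mvEval_right_zero hx] at h
  convert h using 1
  ring

theorem Points.val_add_sub_mem {F : FormalGroup O} (x y : F.Points) {N : ℕ}
    (hy : y.val ∈ maximalIdeal O ^ N) :
    (x + y).val - (x.val + y.val) ∈ maximalIdeal O ^ (N + 1) :=
  F.mvEval_pair_sub_add_mem_succ x.mem y.mem hy

theorem mem_fil {F : FormalGroup O} [F.IsComm] {m : ℕ} {x : F.Points} :
    x ∈ F.fil m ↔ x.val ∈ maximalIdeal O ^ m := Iff.rfl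

theorem fil_anti (F : FormalGroup O) [F.IsComm] {m m' : ℕ} (h : m ≤ m') : F.fil m' ≤ F.fil m :=
  fun _ hx => Ideal.pow_le_pow_right h hx

/-- Two points are congruent modulo `𝔪 ^ N` as elements of `O` if and only if their difference
in the group lies in the `N`-th step of the filtration. -/
theorem sub_mem_fil_iff {F : FormalGroup O} [F.IsComm] {N : ℕ} {x y : F.Points} :
    x - y ∈ F.fil N ↔ x.val - y.val ∈ maximalIdeal O ^ N := by
  obtain ⟨z, rfl⟩ : ∃ z, x = y + z := ⟨x - y, by abel⟩
  rw [add_sub_cancel_left]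
  constructor
  · intro hz
    have h := Ideal.pow_le_pow_right (Nat.le_succ N) (Points.val_add_sub_mem y z hz)
    have := add_mem h (mem_fil.1 hz)
    convert this using 1
    ring
  · intro h
    -- The estimate for `y + z` improves only with the depth already known for `z`, so the depth is
    -- raised one step at a time.
    suffices H : ∀ k ≤ N, z ∈ F.fil k from H N le_rfl
    intro k
    induction k with
    | zero => intro _; simp [mem_fil]
    | succ k ih =>
      intro hk
      have h1 := Points.val_add_sub_mem y z (ih (by omega))
      have := sub_mem (Ideal.pow_le_pow_right hk h) h1
      rw [mem_fil]
      convert this using 1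
      ring

namespace Hom

variable {F G H : FormalGroup O}

theorem onPoints_val [F.IsComm] [G.IsComm] (f : Hom F G) (x : F.Points) :
    (f.onPoints x).val = psEval x.val f.series := rfl

theorem onPoints_comp [F.IsComm] [G.IsComm] [H.IsComm] (f : Hom G H) (g : Hom F G) :
    (f.comp g).onPoints = f.onPoints.comp g.onPoints := by
  ext x
  exact psEval_subst x.mem g.constantCoeff_series f.series

theorem onPoints_id [F.IsComm] : (Hom.id F).onPoints = AddMonoidHom.id _ := by
  ext x
  exact psEval_X x.mem

theorem onPoints_mem_fil [F.IsComm] [G.IsComm] (f : Hom F G) {x : F.Points} {m : ℕ}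
    (hx : x ∈ F.fil m) : f.onPoints x ∈ G.fil m := by
  rcases eq_or_ne m 0 with rfl | hm
  · simp [mem_fil]
  · exact psEval_mem hm hx f.constantCoeff_series

/-- Successive approximation: if `f` induces surjections `F^j / F^{j+1} → G^{j+t} / G^{j+t+1}` for
all `j ≥ j₀`, then it maps `F^{j₀}` onto a subgroup containing `G^{j₀+t}`. -/
theorem exists_onPoints_eq_of_graded [F.IsComm] [G.IsComm] (f : Hom F G) {j₀ t : ℕ}
    (h : ∀ j, j₀ ≤ j → ∀ z ∈ G.fil (j + t), ∃ x ∈ F.fil j, z - f.onPoints x ∈ G.fil (j + t + 1))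
    {z : G.Points} (hz : z ∈ G.fil (j₀ + t)) : ∃ x ∈ F.fil j₀, f.onPoints x = z := by
  classical
  have step : ∀ (k : ℕ) (x : F.Points), z - f.onPoints x ∈ G.fil (j₀ + k + t) →
      ∃ x', x' - x ∈ F.fil (j₀ + k) ∧ z - f.onPoints x' ∈ G.fil (j₀ + (k + 1) + t) := by
    intro k x hx
    obtain ⟨y, hy, hy'⟩ := h (j₀ + k) (by omega) _ hx
    refine ⟨x + y, by simpa using hy, ?_⟩
    rw [map_add, ← sub_sub]
    convert hy' using 2
    omega
  choose! nxt hn1 hn2 using step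
  -- Approximate preimages of `z`: the `k`-th has error in `G^{j₀+k+t}`, and consecutive ones differ
  -- by a point of `F^{j₀+k}`, so they converge inside `F^{j₀}`.
  let u : ℕ → F.Points := fun k => Nat.rec 0 nxt k
  have hu : ∀ k, z - f.onPoints (u k) ∈ G.fil (j₀ + k + t) := fun k => by
    induction k with
    | zero => simpa [u] using hz
    | succ k ih => exact hn2 k _ ih
  have hd : ∀ k, u (k + 1) - u k ∈ F.fil (j₀ + k) := fun k => hn1 k _ (hu k)
  have hdd : ∀ {m n : ℕ}, m ≤ n → u m - u n ∈ F.fil (j₀ + m) := by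
    intro m n hmn
    induction n, hmn using Nat.le_induction with
    | base => simp
    | succ n hmn ih =>
      have := sub_mem ih (F.fil_anti (by omega) (hd n) : _ ∈ F.fil (j₀ + m))
      convert this using 1
      abel
  have hcau : ∀ {m n : ℕ}, m ≤ n → (u m).val ≡ (u n).val
      [SMOD (maximalIdeal O ^ m • ⊤ : Submodule O O)] := by
    intro m n hmn
    rw [SModEq.sub_mem, smul_eq_mul, Ideal.mul_top]
    exact Ideal.pow_le_pow_right (by omega) (sub_mem_fil_iff.1 (hdd hmn))
  obtain ⟨y, hy⟩ := IsPrecomplete.prec (I := maximalIdeal O) inferInstance hcau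
  simp only [SModEq.sub_mem, smul_eq_mul, Ideal.mul_top] at hy
  have hym : y ∈ maximalIdeal O := by
    have := sub_mem (u 1).mem (by simpa using hy 1)
    simpa using this
  have hconv : ∀ k, u k - ⟨y, hym⟩ ∈ F.fil k := fun k => sub_mem_fil_iff.2 (hy k)
  refine ⟨⟨y, hym⟩, ?_, ?_⟩
  · have h0 : u 0 = 0 := rfl
    have := add_mem (F.fil_anti (by omega) (hdd (Nat.zero_le j₀)) : _ ∈ F.fil j₀) (hconv j₀)
    rw [h0] at this
    have h2 := neg_mem this
    convert h2 using 1
    abel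
  · refine sub_eq_zero.1 ?_
    have key : ∀ k, f.onPoints ⟨y, hym⟩ - z ∈ G.fil k := fun k => by
      have h1 := f.onPoints_mem_fil (hconv k)
      rw [map_sub] at h1
      have h2 := add_mem h1 (G.fil_anti (by omega) (hu k) : _ ∈ G.fil k)
      have h3 := neg_mem h2
      convert h3 using 1
      abel
    refine Points.ext (IsHausdorff.haus (I := maximalIdeal O) inferInstance _ fun k => ?_)
    rw [SModEq.sub_mem, smul_eq_mul, Ideal.mul_top, sub_zero]
    exact key k

end Hom

end FormalGroup

/-! ### Expansions in powers of a uniformizer -/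

section Uniformizer

variable {O : Type*} [CommRing O] [IsDomain O] [IsDiscreteValuationRing O] {π : O}

theorem Irreducible.mem_maximalIdeal_pow (hπ : Irreducible π) {N : ℕ} {x : O} :
    x ∈ maximalIdeal O ^ N ↔ π ^ N ∣ x := by
  rw [hπ.maximalIdeal_eq, Ideal.span_singleton_pow, Ideal.mem_span_singleton]

theorem Irreducible.mem_maximalIdeal_iff_dvd (hπ : Irreducible π) {x : O} :
    x ∈ maximalIdeal O ↔ π ∣ x := by
  rw [hπ.maximalIdeal_eq, Ideal.mem_span_singleton]

theorem Irreducible.residue_eq_iff_dvd (hπ : Irreducible π) {x y : O} :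
    residue O x = residue O y ↔ π ∣ x - y := by
  rw [← sub_eq_zero, ← map_sub, residue_eq_zero_iff, hπ.mem_maximalIdeal_iff_dvd]

theorem Irreducible.residue_self (hπ : Irreducible π) : residue O π = 0 :=
  (residue_eq_zero_iff _).2 (hπ.mem_maximalIdeal_iff_dvd.2 dvd_rfl)

theorem Irreducible.exists_eq_pow_mul (hπ : Irreducible π) {x : O} (hx : x ≠ 0) :
    ∃ (j : ℕ) (ξ : O), IsUnit ξ ∧ x = π ^ j * ξ := by
  obtain ⟨j, u, hu⟩ := IsDiscreteValuationRing.eq_unit_mul_pow_irreducible hx hπ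
  exact ⟨j, u, u.isUnit, by rw [hu, mul_comm]⟩

theorem isUnit_iff_residue_ne_zero {x : O} : IsUnit x ↔ residue O x ≠ 0 := by
  rw [Ne, residue_eq_zero_iff, mem_maximalIdeal, mem_nonunits_iff, not_not]

theorem Irreducible.addVal_pow_mul (hπ : Irreducible π) {ξ : O} (hξ : IsUnit ξ) (j : ℕ) :
    (IsDiscreteValuationRing.addVal O (π ^ j * ξ)).toNat = j := by
  obtain ⟨u, rfl⟩ := hξ
  rw [mul_comm, IsDiscreteValuationRing.addVal_def' u hπ j]
  rfl

theorem Irreducible.pow_mul_inj (hπ : Irreducible π) {j : ℕ} {x y : O}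
    (h : π ^ j * x = π ^ j * y) : x = y :=
  mul_left_cancel₀ (pow_ne_zero _ hπ.ne_zero) h

theorem Irreducible.pow_mul_not_mem (hπ : Irreducible π) {j : ℕ} {ξ : O} (hξ : IsUnit ξ) :
    π ^ j * ξ ∉ maximalIdeal O ^ (j + 1) := by
  rw [hπ.mem_maximalIdeal_pow, pow_succ,
    mul_dvd_mul_iff_left (pow_ne_zero _ hπ.ne_zero)]
  exact fun h => hπ.not_isUnit (isUnit_of_dvd_unit h hξ)

/-- The quotient `x / π ^ m` of an element `x` divisible by `π ^ m`. -/
def divPow (π : O) (m : ℕ) (x : O) : O :=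
  open Classical in if h : π ^ m ∣ x then h.choose else 0

theorem Irreducible.divPow_eq (hπ : Irreducible π) {m : ℕ} {x c : O} (h : x = π ^ m * c) :
    divPow π m x = c := by
  have hd : π ^ m ∣ x := ⟨c, h⟩
  rw [divPow, dif_pos hd]
  exact hπ.pow_mul_inj (hd.choose_spec.symm.trans h)

theorem Irreducible.mul_divPow (hπ : Irreducible π) {m : ℕ} {x : O}
    (h : x ∈ maximalIdeal O ^ m) : π ^ m * divPow π m x = x := by
  obtain ⟨c, hc⟩ := hπ.mem_maximalIdeal_pow.1 h
  rw [hπ.divPow_eq hc, hc]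

end Uniformizer

/-! ### Graded pieces as quotients of the residue field -/

namespace FormalGroup

variable {O : Type*} [CommRing O] [IsDomain O] [IsDiscreteValuationRing O]
  [IsAdicComplete (maximalIdeal O) O] {π : O}

/-- The homomorphism `F^m(K) → k` sending `π ^ m * c` to the residue class of `c`. -/
def gradedMap (hπ : Irreducible π) (F : FormalGroup O) [F.IsComm] (m : ℕ) :
    F.fil m →+ ResidueField O :=
  AddMonoidHom.mk' (fun x => residue O (divPow π m x.1.val)) fun x y => by
    have hx := hπ.mul_divPow (mem_fil.1 x.2)
    have hy := hπ.mul_divPow (mem_fil.1 y.2)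
    obtain ⟨c, hc⟩ := hπ.mem_maximalIdeal_pow.1 (Points.val_add_sub_mem x.1 y.1 y.2)
    rw [← map_add, hπ.divPow_eq (c := divPow π m x.1.val + divPow π m y.1.val + π * c)]
    · simp [hπ.residue_self]
    · rw [mul_add, mul_add, hx, hy, ← mul_assoc, ← pow_succ, ← hc]
      simp

theorem gradedMap_eq (hπ : Irreducible π) {F : FormalGroup O} [F.IsComm] {m : ℕ} (x : F.fil m)
    {c : O} (h : x.1.val = π ^ m * c) : gradedMap hπ F m x = residue O c := by
  change residue O (divPow π m x.1.val) = _
  rw [hπ.divPow_eq h]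

theorem gradedMap_surjective (hπ : Irreducible π) (F : FormalGroup O) [F.IsComm] {m : ℕ}
    (hm : m ≠ 0) : Function.Surjective (gradedMap hπ F m) := by
  intro c
  obtain ⟨ξ, rfl⟩ := residue_surjective c
  have h : π ^ m * ξ ∈ maximalIdeal O ^ m := hπ.mem_maximalIdeal_pow.2 ⟨ξ, rfl⟩
  exact ⟨⟨⟨π ^ m * ξ, Ideal.pow_le_self hm h⟩, h⟩, gradedMap_eq hπ _ rfl⟩

theorem gradedMap_eq_zero_iff (hπ : Irreducible π) {F : FormalGroup O} [F.IsComm] {m : ℕ}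
    (x : F.fil m) : gradedMap hπ F m x = 0 ↔ x.1 ∈ F.fil (m + 1) := by
  obtain ⟨c, hc⟩ := hπ.mem_maximalIdeal_pow.1 (mem_fil.1 x.2)
  rw [gradedMap_eq hπ x hc, residue_eq_zero_iff, hπ.mem_maximalIdeal_iff_dvd, mem_fil,
    hπ.mem_maximalIdeal_pow, hc, pow_succ, mul_dvd_mul_iff_left (pow_ne_zero _ hπ.ne_zero)]

namespace Hom

variable {F G : FormalGroup O} [F.IsComm] [G.IsComm]

/-- The group of leading coefficients, in degree `m`, of the elements of `φ F(K)`. -/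
def leadGroup (hπ : Irreducible π) (φ : Hom F G) (m : ℕ) : AddSubgroup (ResidueField O) :=
  (φ.onPoints.range.addSubgroupOf (G.fil m)).map (gradedMap hπ G m)

theorem mem_leadGroup {hπ : Irreducible π} {φ : Hom F G} {m : ℕ} {c : ResidueField O} :
    c ∈ φ.leadGroup hπ m ↔
      ∃ (x : F.Points) (ξ : O), (φ.onPoints x).val = π ^ m * ξ ∧ residue O ξ = c := by
  constructor
  · rintro ⟨z, ⟨x, hx⟩, rfl⟩
    obtain ⟨ξ, hξ⟩ := hπ.mem_maximalIdeal_pow.1 (mem_fil.1 z.2)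
    refine ⟨x, ξ, ?_, (gradedMap_eq hπ z hξ).symm⟩
    rw [hx]
    exact hξ
  · rintro ⟨x, ξ, hx, rfl⟩
    have hm : φ.onPoints x ∈ G.fil m := mem_fil.2 (hπ.mem_maximalIdeal_pow.2 ⟨ξ, hx⟩)
    exact ⟨⟨_, hm⟩, ⟨x, rfl⟩, gradedMap_eq hπ _ hx⟩

/-- Both groups are quotients of `G^m(K)` with the same kernel, the points of `G^m(K)` congruent
modulo `G^{m+1}(K)` to a point of the image. Degree `0` is excluded because points lie in `𝔪`, so
there `gradedMap` is not onto. -/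
theorem nonempty_gr_equiv (hπ : Irreducible π) (φ : Hom F G) {m : ℕ} (hm : m ≠ 0) :
    Nonempty (φ.gr m ≃+ ResidueField O ⧸ φ.leadGroup hπ m) := by
  let q := QuotientAddGroup.mk' φ.onPoints.range
  have hq : ∀ x : G.fil m, q x.1 ∈ φ.cokerFil m := fun x => ⟨x.1, x.2, rfl⟩
  let α : G.fil m →+ φ.cokerFil m := (q.comp (G.fil m).subtype).codRestrict _ hq
  let f₁ : G.fil m →+ φ.gr m := (QuotientAddGroup.mk' _).comp α
  let f₂ : G.fil m →+ ResidueField O ⧸ φ.leadGroup hπ m :=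
    (QuotientAddGroup.mk' _).comp (gradedMap hπ G m)
  have h₁ : Function.Surjective f₁ := by
    refine (QuotientAddGroup.mk'_surjective _).comp ?_
    rintro ⟨_, x, hx, rfl⟩
    exact ⟨⟨x, hx⟩, rfl⟩
  have h₂ : Function.Surjective f₂ :=
    (QuotientAddGroup.mk'_surjective _).comp (gradedMap_surjective hπ G hm)
  have hk : f₁.ker = f₂.ker := by
    ext x
    have e₁ : f₁ x = 0 ↔ q x.1 ∈ φ.cokerFil (m + 1) := by
      refine (QuotientAddGroup.eq_zero_iff _).trans ?_
      rw [AddSubgroup.mem_addSubgroupOf]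
      rfl
    have e₂ : f₂ x = 0 ↔ gradedMap hπ G m x ∈ φ.leadGroup hπ m :=
      QuotientAddGroup.eq_zero_iff _
    rw [AddMonoidHom.mem_ker, AddMonoidHom.mem_ker, e₁, e₂]
    constructor
    · rintro ⟨y, hy, hyx⟩
      have hr : -y + x.1 ∈ φ.onPoints.range := QuotientAddGroup.eq.1 hyx
      have hym : y ∈ G.fil m := G.fil_anti (Nat.le_succ m) hy
      refine ⟨⟨-y + x.1, add_mem (neg_mem hym) x.2⟩, hr, ?_⟩
      have : (⟨-y + x.1, add_mem (neg_mem hym) x.2⟩ : G.fil m) = -⟨y, hym⟩ + x := rfl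
      rw [this, map_add, map_neg, (gradedMap_eq_zero_iff hπ ⟨y, hym⟩).2 hy]
      simp
    · rintro ⟨z, hz, hzx⟩
      have h0 : gradedMap hπ G m (x - z) = 0 := by rw [map_sub, hzx, sub_self]
      refine ⟨(x - z).1, (gradedMap_eq_zero_iff hπ _).1 h0, ?_⟩
      refine QuotientAddGroup.eq.2 ?_
      have : -(x - z).1 + x.1 = z.1 := by
        rw [AddSubgroup.coe_sub]
        abel
      rw [this]
      exact hz
  exact ⟨(QuotientAddGroup.quotientKerEquivOfSurjective f₁ h₁).symm.trans
    ((QuotientAddGroup.quotientAddEquivOfEq hk).trans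
      (QuotientAddGroup.quotientKerEquivOfSurjective f₂ h₂))⟩

theorem nonempty_gr_equiv_residueField (hπ : Irreducible π) (φ : Hom F G) {m : ℕ} (hm : m ≠ 0)
    (h : φ.leadGroup hπ m = ⊥) : Nonempty (φ.gr m ≃+ ResidueField O) := by
  obtain ⟨e⟩ := φ.nonempty_gr_equiv hπ hm
  exact ⟨e.trans ((QuotientAddGroup.quotientAddEquivOfEq h).trans QuotientAddGroup.quotientBot)⟩

theorem subsingleton_gr (hπ : Irreducible π) (φ : Hom F G) {m : ℕ} (hm : m ≠ 0)
    (h : φ.leadGroup hπ m = ⊤) : Subsingleton (φ.gr m) := by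
  obtain ⟨e⟩ := φ.nonempty_gr_equiv hπ hm
  have := QuotientAddGroup.subsingleton_quotient_top (G := ResidueField O)
  exact (e.trans (QuotientAddGroup.quotientAddEquivOfEq h)).toEquiv.subsingleton

/-- Two graded pieces are isomorphic if their groups of leading coefficients agree up to
multiplication by a nonzero constant. -/
theorem nonempty_gr_equiv_gr (hπ : Irreducible π) {F' G' : FormalGroup O} [F'.IsComm] [G'.IsComm]
    (φ : Hom F G) (ψ : Hom F' G') {m r : ℕ} (hm : m ≠ 0) (hr : r ≠ 0) {a : ResidueField O}
    (ha : a ≠ 0) (h : ∀ c, a * c ∈ φ.leadGroup hπ m ↔ c ∈ ψ.leadGroup hπ r) :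
    Nonempty (φ.gr m ≃+ ψ.gr r) := by
  obtain ⟨e⟩ := φ.nonempty_gr_equiv hπ hm
  obtain ⟨e'⟩ := ψ.nonempty_gr_equiv hπ hr
  let μ : ResidueField O ≃+ ResidueField O := DistribMulAction.toAddEquiv₀ _ a ha
  have hμ : (ψ.leadGroup hπ r).map μ.toAddMonoidHom = φ.leadGroup hπ m := by
    ext c
    constructor
    · rintro ⟨x, hx, rfl⟩
      exact (h x).2 hx
    · intro hc
      refine ⟨a⁻¹ * c, (h _).1 ?_, ?_⟩
      · rwa [mul_inv_cancel_left₀ ha]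
      · exact mul_inv_cancel_left₀ ha c
  exact ⟨e.trans ((QuotientAddGroup.congr _ _ μ hμ).symm.trans e'.symm)⟩

theorem subsingleton_gr_of_cokerFil (φ : Hom F G) {m : ℕ} (h : φ.cokerFil m = ⊥) :
    Subsingleton (φ.gr m) := by
  have : Subsingleton (φ.cokerFil m) := by
    rw [h]
    infer_instance
  exact (QuotientAddGroup.mk_surjective).subsingleton

theorem cokerFil_eq_bot (φ : Hom F G) {m : ℕ} (h : G.fil m ≤ φ.onPoints.range) :
    φ.cokerFil m = ⊥ := by
  rw [cokerFil, AddSubgroup.map_eq_bot_iff, QuotientAddGroup.ker_mk']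
  exact h

end Hom

end FormalGroup

/-! ### Weierstrass preparation, height and kernels -/

/-- The difference of the two monic polynomials has smaller degree but still vanishes at all the `r
i`. -/
theorem Polynomial.Monic.eq_prod_X_sub_C {R ι : Type*} [CommRing R] [IsDomain R] [Fintype ι]
    {Q : Polynomial R} (hQ : Q.Monic) (hd : Q.natDegree = Fintype.card ι) {r : ι → R}
    (hr : Function.Injective r) (h : ∀ i, Q.eval (r i) = 0) :
    Q = ∏ i, (Polynomial.X - Polynomial.C (r i)) := by
  have hP : (∏ i, (Polynomial.X - Polynomial.C (r i))).Monic :=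
    Polynomial.monic_prod_of_monic _ _ fun i _ => Polynomial.monic_X_sub_C _
  have hdP : (∏ i, (Polynomial.X - Polynomial.C (r i))).natDegree = Fintype.card ι := by
    rw [Polynomial.natDegree_prod_of_monic _ _ fun i _ => Polynomial.monic_X_sub_C _]
    simp
  by_contra hne
  have hlt : (Q - ∏ i, (Polynomial.X - Polynomial.C (r i))).degree < Q.degree :=
    Polynomial.degree_sub_lt_left (by rw [Polynomial.degree_eq_natDegree hQ.ne_zero,
      Polynomial.degree_eq_natDegree hP.ne_zero, hd, hdP]) hQ.ne_zero
      (by rw [hQ.leadingCoeff, hP.leadingCoeff])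
  refine hne (sub_eq_zero.1 (Polynomial.eq_zero_of_natDegree_lt_card_of_eval_eq_zero _ hr ?_ ?_))
  · intro i
    rw [Polynomial.eval_sub, h, Polynomial.eval_prod, Finset.prod_eq_zero (Finset.mem_univ i)]
    · simp
    · simp
  · rw [← hd]
    exact Polynomial.natDegree_lt_natDegree (sub_ne_zero.2 hne) hlt

namespace PowerSeries

variable {O : Type*} [CommRing O] [IsLocalRing O]

theorem exists_weierstrass_of_order [IsAdicComplete (maximalIdeal O) O] {f : PowerSeries O} {d : ℕ}
    (h : (f.map (residue O)).order = d) :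
    ∃ (P : Polynomial O) (u : PowerSeries O), P.IsDistinguishedAt (maximalIdeal O) ∧
      P.natDegree = d ∧ IsUnit (constantCoeff u) ∧ f = P * u := by
  have h0 : f.map (residue O) ≠ 0 := fun h0 => by simp [h0] at h
  obtain ⟨P, u, H⟩ := exists_isWeierstrassFactorization h0
  exact ⟨P, u, H.isDistinguishedAt, by rw [H.natDegree_eq_toNat_order_map, h]; rfl,
    isUnit_iff_constantCoeff.1 H.isUnit, H.eq_mul⟩

/-- A distinguished polynomial reduces to a pure power of `T`. This identifies the unit factor at
the origin, modulo `𝔪`, with the top coefficient in the statement of the theorem. -/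
theorem residue_coeff_of_distinguished {f : PowerSeries O} {P : Polynomial O} {u : PowerSeries O}
    (hP : P.IsDistinguishedAt (maximalIdeal O)) (h : f = P * u) :
    residue O (coeff P.natDegree f) = residue O (constantCoeff u) := by
  have e : f.map (residue O) = X ^ P.natDegree * u.map (residue O) := by
    rw [h, map_mul, ← Polynomial.polynomial_map_coe]
    have : P.map (residue O) = Polynomial.X ^ P.natDegree := hP.map_eq_X_pow
    rw [this, Polynomial.coe_pow, Polynomial.coe_X]
  have := congrArg (coeff P.natDegree) e
  rw [coeff_map, coeff_X_pow_mul', if_pos le_rfl, Nat.sub_self, coeff_map,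
    coeff_zero_eq_constantCoeff_apply] at this
  exact this

/-- Over a domain, orders multiply under substitution. -/
theorem order_subst_of_domain {R : Type*} [CommRing R] [IsDomain R] {f g : PowerSeries R}
    {d e : ℕ} (hf : f.order = d) (hg : g.order = e) (he : e ≠ 0) :
    order (f.subst g : PowerSeries R) = (d * e : ℕ) := by
  have hg0 : constantCoeff g = 0 := by
    rw [← coeff_zero_eq_constantCoeff_apply]
    exact coeff_of_lt_order 0 (by rw [hg]; exact_mod_cast Nat.pos_of_ne_zero he)
  have hs : HasSubst g := .of_constantCoeff_zero' hg0
  have hfac : f = X ^ d * f.divXPowOrder := by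
    conv_lhs => rw [← X_pow_order_mul_divXPowOrder (f := f), hf]
    rfl
  have hf0 : f ≠ 0 := fun h => by simp [h] at hf
  have hc : constantCoeff (f.divXPowOrder.subst g) ≠ 0 := by
    have e1 : constantCoeff (f.divXPowOrder.subst g) = constantCoeff f.divXPowOrder := by
      have h2 : f.divXPowOrder = X * (mk fun i => coeff (i + 1) f.divXPowOrder) +
          C (constantCoeff f.divXPowOrder) := eq_X_mul_shift_add_const _
      have h3 := congrArg (fun q => constantCoeff (q.subst g)) h2
      simp only [subst_add hs, subst_mul hs, subst_X hs, map_add, map_mul, hg0, zero_mul,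
        zero_add] at h3
      rw [h3]
      have := subst_C (a := g) (constantCoeff f.divXPowOrder)
      rw [this]
      exact constantCoeff_C _
    rw [e1, constantCoeff_divXPowOrder]
    have := coeff_order hf0
    simpa using this
  have hz : order (f.divXPowOrder.subst g : PowerSeries R) = 0 := by
    by_contra hne
    exact hc (one_le_order_iff_constCoeff_eq_zero.1 (Order.one_le_iff_ne_zero.2 hne))
  rw [hfac, subst_mul hs, subst_pow hs, subst_X hs, order_mul, hz, order_pow, hg]
  simp

end PowerSeries

namespace FormalGroup.Hom

section Height

variable {O : Type*} [CommRing O] [IsLocalRing O] [IsAdicComplete (maximalIdeal O) O]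
  {F G H : FormalGroup O}

/-- The reduction is a series in `T^p` without constant term, whose `T^p` coefficient is the residue
of the unit `D(ψ)`. -/
theorem HasHeight.order {p : ℕ} (hp : p ≠ 0) {f : Hom F G} (h : f.HasHeight p 1) :
    (f.series.map (residue O)).order = p := by
  obtain ⟨ψ, hψ, e⟩ := h
  rw [pow_one] at e
  rw [PowerSeries.order_eq_nat]
  constructor
  · rw [e, PowerSeries.coeff_map, PowerSeries.coeff_subst_X_pow hp, if_pos dvd_rfl,
      Nat.div_self (Nat.pos_of_ne_zero hp)]
    exact (hψ.map (residue O)).ne_zero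
  · intro i hi
    rcases Nat.eq_zero_or_pos i with rfl | hi0
    · simp [f.constantCoeff_series]
    · rw [e, PowerSeries.coeff_map, PowerSeries.coeff_subst_X_pow hp,
        if_neg (Nat.not_dvd_of_pos_of_lt hi0 hi), map_zero]

theorem order_comp {f : Hom G H} {g : Hom F G} {d e : ℕ}
    (hf : (f.series.map (residue O)).order = d) (hg : (g.series.map (residue O)).order = e)
    (he : e ≠ 0) : ((f.comp g).series.map (residue O)).order = (d * e : ℕ) := by
  have hs : PowerSeries.HasSubst g.series := .of_constantCoeff_zero' g.constantCoeff_series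
  have : PowerSeries.map (residue O) (PowerSeries.subst g.series f.series) =
      PowerSeries.subst (PowerSeries.map (residue O) g.series)
        (PowerSeries.map (residue O) f.series) := PowerSeries.map_subst hs _
  change (PowerSeries.map (residue O) (PowerSeries.subst g.series f.series)).order = _
  rw [this]
  exact PowerSeries.order_subst_of_domain hf hg he

variable [F.IsComm] [G.IsComm]

theorem mem_ker_iff_eval {f : Hom F G} {P : Polynomial O} {u : PowerSeries O}
    (hu : IsUnit (PowerSeries.constantCoeff u)) (h : f.series = P * u) {x : F.Points} :
    x ∈ f.onPoints.ker ↔ P.eval x.val = 0 := by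
  have hux : IsUnit (psEval x.val u) := by
    rw [← psEvalHom_apply x.mem]
    exact (PowerSeries.isUnit_iff_constantCoeff.2 hu).map _
  rw [AddMonoidHom.mem_ker, Points.ext_iff, onPoints_val, h, psEval_mul x.mem, psEval_coe x.mem,
    Points.val_zero, hux.mul_left_eq_zero]

end Height

section Factorization

variable {O : Type*} [CommRing O] [IsLocalRing O] [IsDomain O] [IsAdicComplete (maximalIdeal O) O]
  {F G : FormalGroup O} [F.IsComm] [G.IsComm]

/-- Kernel points are roots of the Weierstrass polynomial, which has degree `d`. -/
theorem finite_ker {f : Hom F G} {d : ℕ} (h : (f.series.map (residue O)).order = d) :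
    Finite f.onPoints.ker ∧ Nat.card f.onPoints.ker ≤ d := by
  classical
  obtain ⟨P, u, hP, hd, hu, e⟩ := PowerSeries.exists_weierstrass_of_order h
  let r : f.onPoints.ker → P.roots.toFinset := fun x => ⟨x.1.val, by
    rw [Multiset.mem_toFinset, Polynomial.mem_roots hP.monic.ne_zero]
    exact (mem_ker_iff_eval hu e).1 x.2⟩
  have hr : Function.Injective r := fun x y hxy =>
    Subtype.ext (Points.ext (congrArg Subtype.val hxy))
  refine ⟨Finite.of_injective r hr, (Nat.card_le_card_of_injective r hr).trans ?_⟩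
  rw [Nat.card_eq_fintype_card, Fintype.card_coe, ← hd]
  exact (Multiset.toFinset_card_le _).trans (Polynomial.card_roots' P)

/-- If the kernel of `f` on points is as large as it can be, then `f` is a unit times the product
of the `T - w`, for `w` in the kernel. -/
theorem exists_eq_prod_mul {f : Hom F G} {d : ℕ} (h : (f.series.map (residue O)).order = d)
    [Fintype f.onPoints.ker] (hc : Fintype.card f.onPoints.ker = d) :
    ∃ u : PowerSeries O, IsUnit (PowerSeries.constantCoeff u) ∧
      residue O (PowerSeries.coeff d f.series) = residue O (PowerSeries.constantCoeff u) ∧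
      f.series = ((∏ w : f.onPoints.ker, (Polynomial.X - Polynomial.C w.1.val) : Polynomial O) :
        PowerSeries O) * u := by
  obtain ⟨P, u, hP, hd, hu, e⟩ := PowerSeries.exists_weierstrass_of_order h
  refine ⟨u, hu, ?_, ?_⟩
  · rw [← hd]
    exact PowerSeries.residue_coeff_of_distinguished hP e
  · rw [← hP.monic.eq_prod_X_sub_C (hd.trans hc.symm) (r := fun w : f.onPoints.ker => w.1.val)]
    · exact e
    · exact fun x y hxy => Subtype.ext (Points.ext hxy)
    · exact fun w => (mem_ker_iff_eval hu e).1 w.2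

end Factorization

end FormalGroup.Hom

/-! ### Leading terms of an isogeny of height one -/

namespace FormalGroup.Hom

variable {O : Type*} [CommRing O] [IsDomain O] [IsDiscreteValuationRing O]
  [IsAdicComplete (maximalIdeal O) O] {π : O} {F G : FormalGroup O} [F.IsComm] [G.IsComm]

/-- The behaviour of a homomorphism `f` of height one all of whose kernel is rational: the nonzero
elements of the kernel have valuation `s`, the linear coefficient of `f` is `π ^ ((p - 1) * s) * a`,
the coefficient of `T ^ p` is `b`, and on elements of valuation `j` the leading term of `f` is given
by the term of degree `p`, by the linear term, or by both, according to the position of `j` with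
respect to `s`. -/
structure Profile (π : O) (p : ℕ) (f : Hom F G) (s : ℕ) (a b : O) : Prop where
  ne_zero : s ≠ 0
  isUnit_lin : IsUnit a
  isUnit_top : IsUnit b
  linCoeff_eq : f.linCoeff = π ^ ((p - 1) * s) * a
  coeff_eq : PowerSeries.coeff p f.series = b
  low : ∀ j, j ≠ 0 → j < s → ∀ ξ : O, ∃ η, psEval (π ^ j * ξ) f.series = π ^ (p * j) * η ∧
    residue O η = residue O b * residue O ξ ^ p
  mid : ∀ ξ : O, ∃ η, psEval (π ^ s * ξ) f.series = π ^ (p * s) * η ∧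
    residue O η = residue O a * residue O ξ + residue O b * residue O ξ ^ p
  high : ∀ j, s < j → ∀ ξ : O, ∃ η, psEval (π ^ j * ξ) f.series = π ^ (j + (p - 1) * s) * η ∧
    residue O η = residue O a * residue O ξ
  ker_val : ∀ w ∈ f.onPoints.ker, w ≠ 0 → ∃ ω, IsUnit ω ∧ w.val = π ^ s * ω
  ker_lift : ∀ ξ : O, residue O a * residue O ξ + residue O b * residue O ξ ^ p = 0 →
    ∃ w ∈ f.onPoints.ker, ∃ ω, w.val = π ^ s * ω ∧ residue O ω = residue O ξ

/-- Every nonzero element generates a group of prime order, so a step of the filtration containing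
one nonzero kernel point contains them all. -/
theorem exists_ker_val (hπ : Irreducible π) {p : ℕ} [hp : Fact p.Prime] {f : Hom F G}
    (hc : Nat.card f.onPoints.ker = p) :
    ∃ s, s ≠ 0 ∧ f.onPoints.ker ≤ F.fil s ∧ ∀ w ∈ f.onPoints.ker, w ≠ 0 →
      ∃ ω, IsUnit ω ∧ w.val = π ^ s * ω := by
  have hfin : Finite f.onPoints.ker := Nat.finite_of_card_ne_zero (by rw [hc]; exact hp.out.ne_zero)
  have hnt : Nontrivial f.onPoints.ker :=
    Finite.one_lt_card_iff_nontrivial.1 (by rw [hc]; exact hp.out.one_lt)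
  obtain ⟨w₀, hw₀⟩ := exists_ne (0 : f.onPoints.ker)
  have hv : w₀.1.val ≠ 0 := fun h => hw₀ (Subtype.ext (Points.ext h))
  obtain ⟨s, ω₀, hω₀, e₀⟩ := hπ.exists_eq_pow_mul hv
  have hs : s ≠ 0 := by
    rintro rfl
    rw [pow_zero, one_mul] at e₀
    exact (mem_maximalIdeal _).1 w₀.1.mem (e₀ ▸ hω₀)
  have hw₀s : w₀.1 ∈ F.fil s := mem_fil.2 (hπ.mem_maximalIdeal_pow.2 ⟨ω₀, e₀⟩)
  have hle : f.onPoints.ker ≤ F.fil s := fun w hw => by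
    have : (⟨w, hw⟩ : f.onPoints.ker) ∈ AddSubgroup.zmultiples w₀ := by
      rw [zmultiples_eq_top_of_prime_card hc hw₀]
      trivial
    obtain ⟨n, hn⟩ := AddSubgroup.mem_zmultiples_iff.1 this
    have hn' : n • w₀.1 = w := congrArg Subtype.val hn
    rw [← hn']
    exact zsmul_mem hw₀s n
  refine ⟨s, hs, hle, fun w hw hw0 => ?_⟩
  obtain ⟨ω, hω⟩ := hπ.mem_maximalIdeal_pow.1 (mem_fil.1 (hle hw))
  refine ⟨ω, ?_, hω⟩
  by_contra hnu
  obtain ⟨c, rfl⟩ := hπ.mem_maximalIdeal_iff_dvd.1 ((mem_maximalIdeal _).2 hnu)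
  have hws : w ∈ F.fil (s + 1) :=
    mem_fil.2 (hπ.mem_maximalIdeal_pow.2 ⟨c, by rw [hω, pow_succ, mul_assoc]⟩)
  have : w₀ ∈ AddSubgroup.zmultiples (⟨w, hw⟩ : f.onPoints.ker) := by
    rw [zmultiples_eq_top_of_prime_card hc fun h => hw0 (congrArg Subtype.val h)]
    trivial
  obtain ⟨n, hn⟩ := AddSubgroup.mem_zmultiples_iff.1 this
  have hn' : n • w = w₀.1 := congrArg Subtype.val hn
  have h1 : w₀.1 ∈ F.fil (s + 1) := hn' ▸ zsmul_mem hws n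
  exact hπ.pow_mul_not_mem hω₀ (e₀ ▸ mem_fil.1 h1)

/-- The polynomial whose roots are the elements of a subgroup of order `p` of a field of
characteristic `p`. -/
theorem prod_X_sub_C_of_injective_addMonoidHom {k A : Type*} [Field k] (p : ℕ) [hp : Fact p.Prime]
    [CharP k p] [AddCommGroup A] [Fintype A] (hA : Fintype.card A = p) (Ω : A →+ k)
    (hΩ : Function.Injective Ω) :
    ∃ c : k, ∏ w, (Polynomial.X - Polynomial.C (Ω w)) =
      (Polynomial.X ^ p - Polynomial.C c * Polynomial.X : Polynomial k) := by
  have hA' : Nat.card A = p := by rw [Nat.card_eq_fintype_card, hA]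
  have hnt : Nontrivial A := Fintype.one_lt_card_iff_nontrivial.1 (by rw [hA]; exact hp.out.one_lt)
  obtain ⟨w₀, hw₀⟩ := exists_ne (0 : A)
  have hdeg : (Polynomial.C (Ω w₀ ^ (p - 1)) * Polynomial.X : Polynomial k).degree < p :=
    (Polynomial.degree_C_mul_X_le _).trans_lt (by exact_mod_cast hp.out.one_lt)
  -- The roots are the multiples `n * Ω w₀` with `n` in the prime field, where `n ^ p = n`; this
  -- dictates the constant.
  refine ⟨Ω w₀ ^ (p - 1), (Polynomial.Monic.eq_prod_X_sub_C (Polynomial.Monic.sub_of_left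
    (Polynomial.monic_X_pow p) ?_)
    ?_ hΩ ?_).symm⟩
  · rwa [Polynomial.degree_X_pow]
  · rw [hA, Polynomial.natDegree_sub_eq_left_of_natDegree_lt, Polynomial.natDegree_X_pow]
    rw [Polynomial.natDegree_X_pow]
    exact (Polynomial.natDegree_C_mul_le _ _).trans_lt
      (by rw [Polynomial.natDegree_X]; exact hp.out.one_lt)
  · intro w
    have : w ∈ AddSubgroup.zmultiples w₀ := by
      rw [zmultiples_eq_top_of_prime_card hA' hw₀]
      trivial
    obtain ⟨n, rfl⟩ := AddSubgroup.mem_zmultiples_iff.1 this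
    have hn : (n : k) ^ p = n := by
      have := frobenius_def (R := k) p (n : k)
      rw [← this, map_intCast]
    simp only [Polynomial.eval_sub, Polynomial.eval_pow, Polynomial.eval_X, Polynomial.eval_mul,
      Polynomial.eval_C, map_zsmul, zsmul_eq_mul]
    rw [mul_pow, hn, mul_left_comm, ← pow_succ, Nat.sub_add_cancel hp.out.one_lt.le, sub_self]

/-- Since `f(x) = u(x) ∏ (x - w)`, the leading term of `f(x)` is found factor by factor: for `w ≠
0`, `x - w` is led by `x`, by both terms, or by `-w`, according to whether `x` has valuation below,
at or above `s`. -/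
theorem exists_profile (hπ : Irreducible π) {p : ℕ} [hp : Fact p.Prime]
    [CharP (ResidueField O) p] {f : Hom F G} (hord : (f.series.map (residue O)).order = p)
    (hc : Nat.card f.onPoints.ker = p) :
    ∃ s a b, f.Profile π p s a b := by
  classical
  obtain ⟨s, hs, hle, hval⟩ := exists_ker_val hπ hc
  have hfin : Finite f.onPoints.ker := Nat.finite_of_card_ne_zero (by rw [hc]; exact hp.out.ne_zero)
  letI : Fintype f.onPoints.ker := Fintype.ofFinite _
  have hc' : Fintype.card f.onPoints.ker = p := by rw [← hc, Nat.card_eq_fintype_card]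
  obtain ⟨u, hu, hbu, hfac⟩ := exists_eq_prod_mul hord hc'
  let ω : f.onPoints.ker → O := fun w => divPow π s w.1.val
  have hω : ∀ w, w.1.val = π ^ s * ω w := fun w => (hπ.mul_divPow (mem_fil.1 (hle w.2))).symm
  have hωu : ∀ w, w ≠ 0 → IsUnit (ω w) := fun w hw => by
    obtain ⟨ω', h1, h2⟩ := hval w.1 w.2 fun h => hw (Subtype.ext h)
    rwa [← hπ.pow_mul_inj ((hω w).symm.trans h2)] at h1
  have hω0 : ω 0 = 0 := hπ.divPow_eq (by simp [Points.val_zero])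
  -- Modulo `𝔪` the formal addition of leading coefficients is ordinary addition, so the reduced
  -- zeros form a subgroup of `k` of order `p`.
  let Ω : f.onPoints.ker →+ ResidueField O := (gradedMap hπ F s).comp (AddSubgroup.inclusion hle)
  have hΩ : ∀ w, Ω w = residue O (ω w) := fun w => rfl
  have hΩi : Function.Injective Ω := by
    rw [injective_iff_map_eq_zero]
    intro w hw
    by_contra h0
    exact (isUnit_iff_residue_ne_zero.1 (hωu w h0)) hw
  obtain ⟨c, hcp⟩ := prod_X_sub_C_of_injective_addMonoidHom p hc' Ω hΩi
  have hcard : (Finset.univ.erase (0 : f.onPoints.ker)).card = p - 1 := by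
    rw [Finset.card_erase_of_mem (Finset.mem_univ _), Finset.card_univ, hc']
  -- Cancel the factor `T` of the zero `w = 0` and compare constant terms.
  have hcc : ∏ w ∈ Finset.univ.erase (0 : f.onPoints.ker), (-Ω w) = -c := by
    rw [← Finset.mul_prod_erase _ _ (Finset.mem_univ (0 : f.onPoints.ker)), map_zero,
      Polynomial.C_0, sub_zero] at hcp
    have e : (Polynomial.X ^ p - Polynomial.C c * Polynomial.X : Polynomial (ResidueField O)) =
        Polynomial.X * (Polynomial.X ^ (p - 1) - Polynomial.C c) := by
      rw [mul_sub, ← pow_succ', Nat.sub_add_cancel hp.out.one_lt.le, mul_comm Polynomial.X]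
    rw [e] at hcp
    have := congrArg (Polynomial.eval 0) (mul_left_cancel₀ Polynomial.X_ne_zero hcp)
    have hp1 : p - 1 ≠ 0 := by have := hp.out.one_lt; omega
    simpa [Polynomial.eval_prod, hp1] using this
  have hev : ∀ ξ : ResidueField O, ∏ w, (ξ - Ω w) = ξ ^ p - c * ξ := fun ξ => by
    simpa [Polynomial.eval_prod] using congrArg (Polynomial.eval ξ) hcp
  set u₀ := PowerSeries.constantCoeff u with hu₀
  have hpe : ∀ x ∈ maximalIdeal O, psEval x f.series = (∏ w : f.onPoints.ker, (x - w.1.val)) *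
      psEval x u := fun x hx => by
    rw [hfac, psEval_mul hx, psEval_coe hx, Polynomial.eval_prod]
    simp
  have hru : ∀ x ∈ maximalIdeal O, residue O (psEval x u) = residue O u₀ := fun x hx => by
    rw [hπ.residue_eq_iff_dvd]
    exact (hπ.mem_maximalIdeal_iff_dvd.1 hx).trans (dvd_psEval_sub_constantCoeff hx u)
  have hmem : ∀ j, j ≠ 0 → ∀ ξ, π ^ j * ξ ∈ maximalIdeal O := fun j hj ξ =>
    Ideal.pow_le_self hj (hπ.mem_maximalIdeal_pow.2 ⟨ξ, rfl⟩)
  -- The linear coefficient is `u₀ ∏_{w ≠ 0} (-w)`; this is what remains after removing `π ^ s` from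
  -- each of the `p - 1` factors.
  set a : O := (∏ w ∈ Finset.univ.erase (0 : f.onPoints.ker), (-ω w)) * u₀ with ha
  have hra : residue O a = -c * residue O u₀ := by
    rw [ha, map_mul, map_prod, ← hcc]
    simp [hΩ]
  have hmid : ∀ ξ : O, ∃ η, psEval (π ^ s * ξ) f.series = π ^ (p * s) * η ∧
      residue O η = residue O a * residue O ξ +
        residue O (PowerSeries.coeff p f.series) * residue O ξ ^ p := fun ξ => by
    refine ⟨(∏ w, (ξ - ω w)) * psEval (π ^ s * ξ) u, ?_, ?_⟩
    · rw [hpe _ (hmem s hs ξ), ← mul_assoc]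
      congr 1
      simp_rw [hω, ← mul_sub]
      rw [Finset.prod_mul_distrib, Finset.prod_const, Finset.card_univ, hc', ← pow_mul, mul_comm s]
    · rw [map_mul, hru _ (hmem s hs ξ), map_prod, hra, hbu]
      simp_rw [map_sub, ← hΩ]
      rw [hev]
      ring
  refine ⟨s, a, PowerSeries.coeff p f.series, hs, ?_, ?_, ?_, rfl, ?_, hmid, ?_, hval, ?_⟩
  · refine IsUnit.mul ?_ hu
    rw [IsUnit.prod_iff]
    exact fun w hw => (hωu w (Finset.ne_of_mem_erase hw)).neg
  · rw [isUnit_iff_residue_ne_zero, hbu]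
    exact isUnit_iff_residue_ne_zero.1 hu
  · rw [linCoeff, hfac, ← Finset.mul_prod_erase _ _ (Finset.mem_univ (0 : f.onPoints.ker))]
    have : ((0 : f.onPoints.ker) : F.Points).val = 0 := rfl
    rw [this, Polynomial.C_0, sub_zero, Polynomial.coe_mul, Polynomial.coe_X, mul_assoc,
      PowerSeries.coeff_succ_X_mul 0, PowerSeries.coeff_zero_eq_constantCoeff_apply, map_mul, ← PowerSeries.coeff_zero_eq_constantCoeff_apply,
      Polynomial.coeff_coe, Polynomial.coeff_zero_eq_eval_zero, Polynomial.eval_prod, ha,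
      ← mul_assoc]
    congr 1
    simp only [Polynomial.eval_sub, Polynomial.eval_X, Polynomial.eval_C, zero_sub, hω,
      ← mul_neg]
    rw [Finset.prod_mul_distrib, Finset.prod_const, hcard, ← pow_mul, mul_comm s]
  · intro j hj hjs ξ
    refine ⟨(∏ w, (ξ - π ^ (s - j) * ω w)) * psEval (π ^ j * ξ) u, ?_, ?_⟩
    · rw [hpe _ (hmem j hj ξ), ← mul_assoc]
      congr 1
      have : ∀ w : f.onPoints.ker, π ^ j * ξ - w.1.val = π ^ j * (ξ - π ^ (s - j) * ω w) :=
        fun w => by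
          rw [mul_sub, ← mul_assoc, ← pow_add, Nat.add_sub_cancel' hjs.le, ← hω]
      simp_rw [this]
      rw [Finset.prod_mul_distrib, Finset.prod_const, Finset.card_univ, hc', ← pow_mul, mul_comm j]
    · rw [map_mul, hru _ (hmem j hj ξ), map_prod, hbu, mul_comm]
      have hsj : s - j ≠ 0 := by omega
      simp [hπ.residue_self, hsj, hc']
  · intro j hjs ξ
    have hj : j ≠ 0 := by omega
    refine ⟨ξ * (∏ w ∈ Finset.univ.erase (0 : f.onPoints.ker), (π ^ (j - s) * ξ - ω w)) *
      psEval (π ^ j * ξ) u, ?_, ?_⟩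
    · rw [hpe _ (hmem j hj ξ), ← mul_assoc, ← mul_assoc,
        ← Finset.mul_prod_erase _ _ (Finset.mem_univ (0 : f.onPoints.ker))]
      congr 1
      have : ∀ w : f.onPoints.ker, π ^ j * ξ - w.1.val = π ^ s * (π ^ (j - s) * ξ - ω w) :=
        fun w => by
          rw [mul_sub, ← mul_assoc, ← pow_add, Nat.add_sub_cancel' hjs.le, ← hω]
      have h0 : ((0 : f.onPoints.ker) : F.Points).val = 0 := rfl
      rw [h0, sub_zero]
      simp_rw [this]
      rw [Finset.prod_mul_distrib, Finset.prod_const, hcard, ← pow_mul, mul_comm s, pow_add]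
      ring
    · rw [map_mul, hru _ (hmem j hj ξ), map_mul, map_prod, hra, ← hcc]
      have hsj : j - s ≠ 0 := by omega
      simp only [map_sub, map_mul, map_pow, hπ.residue_self, zero_pow hsj, zero_mul, zero_sub, hΩ]
      ring
  · intro ξ hξ
    have h1 : residue O u₀ * ∏ w, (residue O ξ - Ω w) = 0 := by
      rw [hev, ← hξ, hra, hbu]
      ring
    rcases mul_eq_zero.1 h1 with h | h
    · exact absurd h (isUnit_iff_residue_ne_zero.1 hu)
    · obtain ⟨w, -, hw⟩ := Finset.prod_eq_zero_iff.1 h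
      exact ⟨w.1, w.2, ω w, hω w, (sub_eq_zero.1 hw).symm⟩

end FormalGroup.Hom

/-! ### Leading coefficients of the image of a composite -/

section Uniformizer

variable {O : Type*} [CommRing O] [IsDomain O] [IsDiscreteValuationRing O] {π : O}

theorem Irreducible.residue_eq_zero_of_lt (hπ : Irreducible π) {m m' : ℕ} {η η' : O}
    (h : π ^ m * η = π ^ m' * η') (hlt : m < m') : residue O η = 0 := by
  obtain ⟨d, rfl⟩ := Nat.exists_eq_add_of_lt hlt
  rw [add_assoc, pow_add, mul_assoc] at h
  rw [hπ.pow_mul_inj h, pow_succ', mul_assoc, map_mul, hπ.residue_self, zero_mul]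

theorem Irreducible.eq_of_pow_mul_eq (hπ : Irreducible π) {m m' : ℕ} {η η' : O}
    (h : π ^ m * η = π ^ m' * η') (hη : residue O η ≠ 0) (hη' : residue O η' ≠ 0) :
    m = m' ∧ η = η' := by
  rcases lt_trichotomy m m' with hlt | rfl | hlt
  · exact absurd (hπ.residue_eq_zero_of_lt h hlt) hη
  · exact ⟨rfl, hπ.pow_mul_inj h⟩
  · exact absurd (hπ.residue_eq_zero_of_lt h.symm hlt) hη'

end Uniformizer

namespace FormalGroup

variable {O : Type*} [CommRing O] [IsDomain O] [IsDiscreteValuationRing O]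
  [IsAdicComplete (maximalIdeal O) O] {π : O}

/-- The point `π ^ j * ξ` of a formal group. -/
def Points.powMul (hπ : Irreducible π) (F : FormalGroup O) {j : ℕ} (hj : j ≠ 0) (ξ : O) :
    F.Points :=
  ⟨π ^ j * ξ, Ideal.pow_le_self hj (hπ.mem_maximalIdeal_pow.2 ⟨ξ, rfl⟩)⟩

theorem Points.exists_eq_pow_mul (hπ : Irreducible π) {F : FormalGroup O} {x : F.Points}
    (hx : x ≠ 0) : ∃ (j : ℕ) (ξ : O), j ≠ 0 ∧ residue O ξ ≠ 0 ∧ x.val = π ^ j * ξ := by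
  obtain ⟨j, ξ, hξ, e⟩ := hπ.exists_eq_pow_mul fun h : x.val = 0 => hx (Points.ext h)
  refine ⟨j, ξ, ?_, isUnit_iff_residue_ne_zero.1 hξ, e⟩
  rintro rfl
  rw [pow_zero, one_mul] at e
  exact (mem_maximalIdeal _).1 x.mem (e ▸ hξ)

theorem Points.mem_fil_of_eq (hπ : Irreducible π) {F : FormalGroup O} [F.IsComm] {x : F.Points}
    {j : ℕ} {ξ : O} (h : x.val = π ^ j * ξ) : x ∈ F.fil j :=
  mem_fil.2 (hπ.mem_maximalIdeal_pow.2 ⟨ξ, h⟩)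

/-- The graded pieces embed in `k`, which is killed by `p`. -/
theorem prime_nsmul_mem_fil_succ (hπ : Irreducible π) {p : ℕ} [CharP (ResidueField O) p]
    {F : FormalGroup O} [F.IsComm] {j : ℕ} {x : F.Points} (hx : x ∈ F.fil j) :
    p • x ∈ F.fil (j + 1) := by
  have := (gradedMap_eq_zero_iff hπ (p • (⟨x, hx⟩ : F.fil j))).1 (by
    rw [map_nsmul, nsmul_eq_mul, CharP.cast_eq_zero, zero_mul])
  exact this

namespace Hom.Profile

variable {F G₁ G₀ : FormalGroup O} [F.IsComm] [G₁.IsComm] [G₀.IsComm]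
  {p : ℕ} [hp : Fact p.Prime] {f : Hom G₁ G₀} {s : ℕ} {a b : O}

theorem residue_lin_ne_zero (h : f.Profile π p s a b) : residue O a ≠ 0 :=
  isUnit_iff_residue_ne_zero.1 h.isUnit_lin

theorem residue_top_ne_zero (h : f.Profile π p s a b) : residue O b ≠ 0 :=
  isUnit_iff_residue_ne_zero.1 h.isUnit_top

theorem val_of_lt (h : f.Profile π p s a b) {y : G₁.Points} {j : ℕ} {ξ : O}
    (hj : j ≠ 0) (hjs : j < s) (hξ : residue O ξ ≠ 0) (hy : y.val = π ^ j * ξ) :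
    ∃ η, (f.onPoints y).val = π ^ (p * j) * η ∧ residue O η = residue O b * residue O ξ ^ p ∧
      residue O η ≠ 0 := by
  obtain ⟨η, h1, h2⟩ := h.low j hj hjs ξ
  refine ⟨η, by rw [onPoints_val, hy, h1], h2, ?_⟩
  rw [h2]
  exact mul_ne_zero h.residue_top_ne_zero (pow_ne_zero _ hξ)

theorem mul_add_mul_eq : p * s = s + (p - 1) * s := by
  obtain ⟨q, hq⟩ := Nat.exists_eq_add_of_lt hp.out.one_lt
  have : p - 1 = q + 1 := by omega
  rw [this, show p = q + 2 by omega]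
  ring

/-- A point whose image has valuation at least `p * s` has valuation at least `s`. -/
theorem exists_eq_pow_mul_of_le (hπ : Irreducible π) (h : f.Profile π p s a b) {y : G₁.Points}
    {m : ℕ} {η : O} (hm : p * s ≤ m) (hy : (f.onPoints y).val = π ^ m * η) :
    ∃ ξ, y.val = π ^ s * ξ := by
  by_cases hy0 : y = 0
  · exact ⟨0, by rw [hy0, Points.val_zero, mul_zero]⟩
  obtain ⟨j, ξ, hj, hξ, e⟩ := Points.exists_eq_pow_mul hπ hy0
  rcases lt_or_ge j s with hjs | hjs
  · obtain ⟨η', h1, -, h3⟩ := h.val_of_lt hj hjs hξ e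
    have : p * j < m := lt_of_lt_of_le (Nat.mul_lt_mul_of_pos_left hjs hp.out.pos) hm
    exact absurd (hπ.residue_eq_zero_of_lt (h1.symm.trans hy) this) h3
  · exact ⟨π ^ (j - s) * ξ, by rw [← mul_assoc, ← pow_add, Nat.add_sub_cancel' hjs, e]⟩

/-- Points of valuation at least `s` land in degree at least `p * s`, so only points of valuation
below `s` contribute, and on these `f` multiplies valuations by `p`. The value `c = 0` is set aside
because it lies in every leading group, including those in degrees prime to `p`. -/
theorem leadGroup_low (hπ : Irreducible π) (h : f.Profile π p s a b) (ψ : Hom F G₁) {m : ℕ}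
    (hm : m < p * s) {c : ResidueField O} (hc0 : c ≠ 0) :
    c ∈ (f.comp ψ).leadGroup hπ m ↔
      ∃ r, m = p * r ∧ r ≠ 0 ∧ ∃ x ∈ ψ.leadGroup hπ r, c = residue O b * x ^ p := by
  constructor
  · intro hc
    obtain ⟨x, η, hx, rfl⟩ := mem_leadGroup.1 hc
    rw [onPoints_comp, AddMonoidHom.comp_apply] at hx
    have hy0 : ψ.onPoints x ≠ 0 := fun h0 => by
      rw [h0, map_zero, Points.val_zero, eq_comm, mul_eq_zero] at hx
      rcases hx with hx | hx
      · exact pow_ne_zero _ hπ.ne_zero hx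
      · exact hc0 (by rw [hx, map_zero])
    obtain ⟨j, ξ, hj, hξ, e⟩ := Points.exists_eq_pow_mul hπ hy0
    rcases lt_or_ge j s with hjs | hjs
    · obtain ⟨η', h1, h2, h3⟩ := h.val_of_lt hj hjs hξ e
      obtain ⟨hm', rfl⟩ := hπ.eq_of_pow_mul_eq (hx.symm.trans h1) hc0 h3
      exact ⟨j, hm', hj, residue O ξ, mem_leadGroup.2 ⟨x, ξ, e, rfl⟩, h2⟩
    · obtain ⟨η', h1, -⟩ := h.mid (π ^ (j - s) * ξ)
      rw [← mul_assoc, ← pow_add, Nat.add_sub_cancel' hjs, ← e] at h1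
      exact absurd (hπ.residue_eq_zero_of_lt (hx.symm.trans h1) hm) hc0
  · rintro ⟨r, rfl, hr, x, hx, rfl⟩
    obtain ⟨x, ξ, hξ, rfl⟩ := mem_leadGroup.1 hx
    obtain ⟨η, h1, h2⟩ := h.low r hr (Nat.lt_of_mul_lt_mul_left hm) ξ
    refine mem_leadGroup.2 ⟨x, η, ?_, h2⟩
    rw [onPoints_comp, AddMonoidHom.comp_apply, onPoints_val, hξ, h1]

theorem leadGroup_mid (hπ : Irreducible π) (h : f.Profile π p s a b) (ψ : Hom F G₁)
    {c : ResidueField O} : c ∈ (f.comp ψ).leadGroup hπ (p * s) ↔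
      ∃ x ∈ ψ.leadGroup hπ s, c = residue O a * x + residue O b * x ^ p := by
  constructor
  · intro hc
    obtain ⟨x, η, hx, rfl⟩ := mem_leadGroup.1 hc
    rw [onPoints_comp, AddMonoidHom.comp_apply] at hx
    obtain ⟨ξ, e⟩ := h.exists_eq_pow_mul_of_le hπ le_rfl hx
    obtain ⟨η', h1, h2⟩ := h.mid ξ
    rw [← e] at h1
    rw [hπ.pow_mul_inj (hx.symm.trans h1), h2]
    exact ⟨residue O ξ, mem_leadGroup.2 ⟨x, ξ, e, rfl⟩, rfl⟩
  · rintro ⟨x, hx, rfl⟩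
    obtain ⟨x, ξ, hξ, rfl⟩ := mem_leadGroup.1 hx
    obtain ⟨η, h1, h2⟩ := h.mid ξ
    refine mem_leadGroup.2 ⟨x, η, ?_, h2⟩
    rw [onPoints_comp, AddMonoidHom.comp_apply, onPoints_val, hξ, h1]

/-- Degrees above `p * s` are also reached from points of valuation exactly `s` whose leading terms
cancel. Such a point agrees to leading order with a kernel point, and subtracting the latter keeps
the image under `f` and increases the valuation; `hker` is what keeps the difference in the image of
`ψ`. -/
theorem leadGroup_high (hπ : Irreducible π) (h : f.Profile π p s a b) (ψ : Hom F G₁)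
    (hker : f.onPoints.ker ≤ ψ.onPoints.range) {r : ℕ} (hr : s < r) (c : ResidueField O) :
    residue O a * c ∈ (f.comp ψ).leadGroup hπ (r + (p - 1) * s) ↔ c ∈ ψ.leadGroup hπ r := by
  constructor
  · intro hc
    rcases eq_or_ne c 0 with rfl | hc0
    · exact zero_mem _
    have hac : residue O a * c ≠ 0 := mul_ne_zero h.residue_lin_ne_zero hc0
    obtain ⟨x, η, hx, hη⟩ := mem_leadGroup.1 hc
    rw [onPoints_comp, AddMonoidHom.comp_apply] at hx
    have hlt : p * s < r + (p - 1) * s := by rw [mul_add_mul_eq]; omega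
    obtain ⟨ξ, e⟩ := h.exists_eq_pow_mul_of_le hπ hlt.le hx
    obtain ⟨η', h1, h2⟩ := h.mid ξ
    rw [← e] at h1
    rw [onPoints_val] at hx
    rw [hπ.residue_eq_zero_of_lt (h1.symm.trans hx) hlt] at h2
    -- The degree `p * s` term vanishes, so `ξ` reduces to a zero of `a x + b x^p`, that is, to the
    -- leading coefficient of a kernel point.
    obtain ⟨w, hw, ω, hwω, hωξ⟩ := h.ker_lift ξ h2.symm
    obtain ⟨z, hz⟩ := hker hw
    have hsub : ψ.onPoints x - w ∈ G₁.fil (s + 1) := by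
      obtain ⟨d, hd⟩ := hπ.residue_eq_iff_dvd.1 hωξ.symm
      rw [sub_mem_fil_iff, hπ.mem_maximalIdeal_pow, e, hwω, ← mul_sub, hd, ← mul_assoc, ← pow_succ]
      exact dvd_mul_right _ _
    have hf : (f.onPoints (ψ.onPoints x - w)).val = π ^ (r + (p - 1) * s) * η := by
      rw [map_sub, (AddMonoidHom.mem_ker).1 hw, sub_zero, onPoints_val, hx]
    have hη0 : residue O η ≠ 0 := by rw [hη]; exact hac
    have hy0 : ψ.onPoints x - w ≠ 0 := fun h0 => by
      rw [h0, map_zero, Points.val_zero, eq_comm, mul_eq_zero] at hf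
      rcases hf with hf | hf
      · exact pow_ne_zero _ hπ.ne_zero hf
      · exact hη0 (by rw [hf, map_zero])
    obtain ⟨j, ξ', hj, hξ', e'⟩ := Points.exists_eq_pow_mul hπ hy0
    have hsj : s < j := by
      by_contra! hle
      exact hπ.pow_mul_not_mem (isUnit_iff_residue_ne_zero.2 hξ')
        (e' ▸ mem_fil.1 (G₁.fil_anti (by omega) hsub))
    obtain ⟨η'', h3, h4⟩ := h.high j hsj ξ'
    rw [onPoints_val, e', h3] at hf
    obtain ⟨hjr, rfl⟩ := hπ.eq_of_pow_mul_eq hf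
      (by rw [h4]; exact mul_ne_zero h.residue_lin_ne_zero hξ') hη0
    obtain rfl : j = r := by omega
    rw [h4] at hη
    rw [← mul_left_cancel₀ h.residue_lin_ne_zero hη]
    exact mem_leadGroup.2 ⟨x - z, ξ', by rw [map_sub, hz, e'], rfl⟩
  · intro hc
    obtain ⟨x, ξ, hξ, rfl⟩ := mem_leadGroup.1 hc
    obtain ⟨η, h1, h2⟩ := h.high r hr ξ
    refine mem_leadGroup.2 ⟨x, η, ?_, h2⟩
    rw [onPoints_comp, AddMonoidHom.comp_apply, onPoints_val, hξ, h1]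

/-- Beyond valuation `s` the map on graded pieces is multiplication by the nonzero residue of `a`,
hence onto, and successive approximation applies. -/
theorem exists_onPoints_eq (hπ : Irreducible π) (h : f.Profile π p s a b) {r : ℕ} (hr : s < r)
    {z : G₀.Points} (hz : z ∈ G₀.fil (r + (p - 1) * s)) : ∃ x ∈ G₁.fil r, f.onPoints x = z := by
  refine f.exists_onPoints_eq_of_graded (fun j hj z hz => ?_) hz
  obtain ⟨ζ, hζ⟩ := hπ.mem_maximalIdeal_pow.1 (mem_fil.1 hz)
  obtain ⟨ξ, hξ⟩ := residue_surjective ((residue O a)⁻¹ * residue O ζ)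
  obtain ⟨η, h1, h2⟩ := h.high j (by omega) ξ
  rw [hξ, mul_inv_cancel_left₀ h.residue_lin_ne_zero] at h2
  refine ⟨Points.powMul hπ G₁ (by omega : j ≠ 0) ξ, Points.mem_fil_of_eq hπ rfl, ?_⟩
  obtain ⟨d, hd⟩ := hπ.residue_eq_iff_dvd.1 h2.symm
  rw [sub_mem_fil_iff, hπ.mem_maximalIdeal_pow]
  change _ ∣ z.val - psEval (π ^ j * ξ) f.series
  rw [h1, hζ, ← mul_sub, hd, ← mul_assoc, ← pow_succ]
  exact dvd_mul_right _ _

/-- Multiplication by `p` raises valuations, and `p • y` has valuation `s`; so `y` has some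
valuation `j < s` and its image has valuation `p * j`. -/
theorem val_lt_of_prime_nsmul (hπ : Irreducible π) [CharP (ResidueField O) p]
    (h : f.Profile π p s a b) {y : G₁.Points} (hpy : p • y ≠ 0) (hk : p • y ∈ f.onPoints.ker)
    {s' : ℕ} {ω : O} (hω : IsUnit ω) (hy : (f.onPoints y).val = π ^ s' * ω) : s' < p * s := by
  have hy0 : y ≠ 0 := fun h0 => hpy (by rw [h0, smul_zero])
  obtain ⟨j, ξ, hj, hξ, e⟩ := Points.exists_eq_pow_mul hπ hy0
  obtain ⟨ω', hω', e'⟩ := h.ker_val _ hk hpy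
  have hjs : j < s := by
    by_contra! hle
    have := G₁.fil_anti (by omega : s + 1 ≤ j + 1)
      (prime_nsmul_mem_fil_succ hπ (p := p) (Points.mem_fil_of_eq hπ e))
    exact hπ.pow_mul_not_mem hω' (e' ▸ mem_fil.1 this)
  obtain ⟨η, h1, -, h3⟩ := h.val_of_lt hj hjs hξ e
  rw [(hπ.eq_of_pow_mul_eq (hy.symm.trans h1) (isUnit_iff_residue_ne_zero.1 hω) h3).1]
  exact Nat.mul_lt_mul_of_pos_left hjs hp.out.pos

end Hom.Profile

end FormalGroup

/-! ### From the geometric kernel to the number of rational zeros -/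

/-- A root `x` of the polynomial factor `P` of a power series `f = P * u` is a zero of `f`, provided
that `x` is topologically nilpotent; no completeness is needed. -/
theorem PowerSeries.hasSum_zero_of_aeval_eq_zero {R S : Type*} [CommRing R] [CommRing S]
    [Algebra R S] (J : Ideal S) {f u : PowerSeries R} {P : Polynomial R} (hf : f = P * u) {x : S}
    (hx : Polynomial.aeval x P = 0) {d : ℕ} (hd : x ^ d ∈ J) :
    letI : TopologicalSpace S := J.adicTopology
    HasSum (fun e : ℕ => PowerSeries.coeff e f • x ^ e) 0 := by
  letI : TopologicalSpace S := J.adicTopology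
  refine J.hasBasis_nhds_zero_adic.tendsto_right_iff.2 fun N _ => ?_
  have hpow : ∀ e, d * N ≤ e → x ^ e ∈ J ^ N := fun e he => by
    obtain ⟨r, rfl⟩ := Nat.exists_eq_add_of_le he
    rw [pow_add, pow_mul]
    exact Ideal.mul_mem_right _ _ (Ideal.pow_mem_pow hd N)
  have hsum : ∑ e ∈ Finset.range (d * N), PowerSeries.coeff e f • x ^ e ∈ J ^ N := by
    have e1 : ∑ e ∈ Finset.range (d * N), PowerSeries.coeff e f • x ^ e =
        Polynomial.aeval x (f.trunc (d * N)) := by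
      rw [Polynomial.aeval_def, PowerSeries.eval₂_trunc_eq_sum_range]
      simp [Algebra.smul_def]
    -- The truncations of `f` and of `P * u` agree below degree `d * N`; at the root `x` of `P` only
    -- a multiple of `x ^ (d * N)` is left.
    have hdvd : Polynomial.X ^ (d * N) ∣ f.trunc (d * N) - P * u.trunc (d * N) := by
      rw [Polynomial.X_pow_dvd_iff]
      intro i hi
      have h1 := congrArg (Polynomial.coeff · i)
        (PowerSeries.trunc_mul_trunc (n := d * N) (P : PowerSeries R) u)
      simp only [PowerSeries.coeff_trunc, if_pos hi] at h1
      rw [Polynomial.coeff_sub, PowerSeries.coeff_trunc, if_pos hi, hf, ← h1,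
        ← Polynomial.coe_mul, Polynomial.coeff_coe, sub_self]
    obtain ⟨Q, hQ⟩ := hdvd
    rw [e1, sub_eq_iff_eq_add.1 hQ]
    simp only [map_add, map_mul, hx, zero_mul, add_zero, map_pow, Polynomial.aeval_X]
    exact Ideal.mul_mem_right _ _ (hpow _ le_rfl)
  filter_upwards [Filter.eventually_ge_atTop (Finset.range (d * N))] with T hT
  rw [← Finset.sum_sdiff hT]
  refine add_mem (Ideal.sum_mem _ fun e he => ?_) hsum
  rw [Algebra.smul_def]
  refine Ideal.mul_mem_left _ _ (hpow e ?_)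
  simpa using (Finset.mem_sdiff.1 he).2

namespace FormalGroup.Hom

variable {O : Type*} [CommRing O] [IsDomain O] [IsDiscreteValuationRing O]
  [IsAdicComplete (maximalIdeal O) O] {π : O} {F G : FormalGroup O} [F.IsComm] [G.IsComm]

theorem eq_zero_of_forall_pow_dvd (hπ : Irreducible π) {x : O} (h : ∀ N, N ≠ 0 → π ^ N ∣ x) :
    x = 0 := by
  by_contra hx
  obtain ⟨j, ξ, hξ, e⟩ := hπ.exists_eq_pow_mul hx
  exact hπ.pow_mul_not_mem hξ (hπ.mem_maximalIdeal_pow.2 (e ▸ h (j + 1) (by omega)))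

/-- If `f` began with `c T^d`, `d ≥ 2`, then comparing `f(x + x)` with `f(x) + f(x)` at points
deeper and deeper in the filtration would give `2^d c = 2 c`, which is impossible in characteristic
zero. -/
theorem linCoeff_ne_zero [CharZero O] (hπ : Irreducible π) {f : Hom F G} (hf : f.series ≠ 0) :
    f.linCoeff ≠ 0 := by
  intro hlin
  set d := f.series.order.toNat with hd
  set g := f.series.divXPowOrder with hg
  set c := PowerSeries.constantCoeff g with hc
  have hfac : f.series = PowerSeries.X ^ d * g := PowerSeries.X_pow_order_mul_divXPowOrder.symm
  have hc0 : c ≠ 0 := by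
    rw [hc, hg, PowerSeries.constantCoeff_divXPowOrder]
    exact PowerSeries.coeff_order hf
  have hd2 : 2 ≤ d := by
    have hcd : PowerSeries.coeff d f.series = c := by
      rw [hfac, PowerSeries.coeff_X_pow_mul', if_pos le_rfl, Nat.sub_self,
        PowerSeries.coeff_zero_eq_constantCoeff_apply]
    by_contra! hlt
    interval_cases d
    · rw [PowerSeries.coeff_zero_eq_constantCoeff_apply, f.constantCoeff_series] at hcd
      exact hc0 hcd.symm
    · exact hc0 (hcd.symm.trans hlin)
  have hev : ∀ x ∈ maximalIdeal O, ∃ e, psEval x f.series = x ^ d * (c + x * e) := fun x hx => by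
    obtain ⟨e, he⟩ := dvd_psEval_sub_constantCoeff hx g
    refine ⟨e, ?_⟩
    rw [hfac, psEval_mul hx, ← psEvalHom_apply hx, map_pow, psEvalHom_apply, psEval_X hx, ← he]
    ring
  have key : ∀ N, N ≠ 0 → π ^ N ∣ c * (2 ^ d - 2) := by
    intro N hN
    let x : F.Points := Points.powMul hπ F hN 1
    have hxv : x.val = π ^ N := mul_one _
    have hxN : x.val ∈ maximalIdeal O ^ N := hπ.mem_maximalIdeal_pow.2 (hxv ▸ dvd_rfl)
    obtain ⟨e₁, he₁⟩ := hπ.mem_maximalIdeal_pow.1 (F.mvEval_pair_sub_add_mem hN hxN hxN)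
    rw [← Points.val_add, hxv] at he₁
    have hxx : (x + x).val = π ^ N * (2 + π ^ N * e₁) := by
      rw [sub_eq_iff_eq_add.1 he₁]
      ring
    obtain ⟨e₂, he₂⟩ := hev _ x.mem
    obtain ⟨e₃, he₃⟩ := hev _ (x + x).mem
    rw [hxv] at he₂
    have hfx : (f.onPoints x).val = (π ^ N) ^ d * (c + π ^ N * e₂) := by
      rw [onPoints_val, hxv, he₂]
    have hNd : N * d ≠ 0 := Nat.mul_ne_zero hN (by omega)
    have hfN : (f.onPoints x).val ∈ maximalIdeal O ^ (N * d) := by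
      rw [hπ.mem_maximalIdeal_pow, hfx, pow_mul]
      exact dvd_mul_right _ _
    obtain ⟨e₄, he₄⟩ := hπ.mem_maximalIdeal_pow.1 (G.mvEval_pair_sub_add_mem hNd hfN hfN)
    rw [← Points.val_add, ← map_add, onPoints_val, he₃, hxx, hfx] at he₄
    -- The discrepancy between formal and ordinary addition in `G` is quadratic, so after division
    -- by `π ^ (N * d)` it is still divisible by `π ^ N`.
    have h2 : π ^ (2 * (N * d)) = (π ^ N) ^ d * (π ^ N * π ^ (N * d - N)) := by
      rw [← pow_mul, ← pow_add, ← pow_add]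
      congr 1
      have : N ≤ N * d := Nat.le_mul_of_pos_right N (by omega)
      omega
    rw [h2, mul_pow] at he₄
    have h3 : (2 + π ^ N * e₁) ^ d * (c + π ^ N * (2 + π ^ N * e₁) * e₃) -
        (c + π ^ N * e₂ + (c + π ^ N * e₂)) = π ^ N * π ^ (N * d - N) * e₄ := by
      refine mul_left_cancel₀ (pow_ne_zero d (pow_ne_zero N hπ.ne_zero)) ?_
      rw [← mul_assoc, ← he₄]
      ring
    obtain ⟨e₅, he₅⟩ : π ^ N ∣ (2 + π ^ N * e₁) ^ d - 2 ^ d := by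
      refine dvd_trans ?_ (sub_dvd_pow_sub_pow _ _ d)
      rw [add_sub_cancel_left]
      exact dvd_mul_right _ _
    refine ⟨π ^ (N * d - N) * e₄ + 2 * e₂ - (2 + π ^ N * e₁) ^ d * ((2 + π ^ N * e₁) * e₃) -
      e₅ * c, ?_⟩
    linear_combination h3 - c * he₅
  have h0 := eq_zero_of_forall_pow_dvd hπ key
  have hne : ((2 : O) ^ d - 2) ≠ 0 := by
    have h4 : 2 < 2 ^ d := by
      calc 2 < 2 ^ 2 := by norm_num
        _ ≤ 2 ^ d := Nat.pow_le_pow_right (by norm_num) hd2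
    rw [sub_ne_zero]
    exact_mod_cast h4.ne'
  exact (mul_ne_zero hc0 hne) h0

/-- The zeros of an isogeny with nonzero linear coefficient are simple. -/
theorem not_sq_dvd_of_mem (hπ : Irreducible π) {f : Hom F G} (hlin : f.linCoeff ≠ 0)
    {P : Polynomial O} {u : PowerSeries O} (h : f.series = P * u) {y : O}
    (hy : y ∈ maximalIdeal O) : ¬ (Polynomial.X - Polynomial.C y) ^ 2 ∣ P := by
  rintro ⟨Q, rfl⟩
  refine hlin (eq_zero_of_forall_pow_dvd hπ fun N hN => ?_)
  let w : F.Points := ⟨y, hy⟩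
  have hpe : ∀ z ∈ maximalIdeal O, (z - y) ^ 2 ∣ psEval z f.series := fun z hz => by
    rw [h, psEval_mul hz, psEval_coe hz]
    simp only [Polynomial.eval_mul, Polynomial.eval_pow, Polynomial.eval_sub, Polynomial.eval_X,
      Polynomial.eval_C, mul_assoc]
    exact dvd_mul_right _ _
  have hw : f.onPoints w = 0 := Points.ext (by
    have := hpe y hy
    rw [sub_self, zero_pow two_ne_zero, zero_dvd_iff] at this
    exact this)
  let x : F.Points := Points.powMul hπ F hN 1
  have hxv : x.val = π ^ N := mul_one _
  have hxN : x ∈ F.fil N := mem_fil.2 (hπ.mem_maximalIdeal_pow.2 (hxv ▸ dvd_rfl))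
  have hd : (w + x).val - y ∈ maximalIdeal O ^ N := by
    have := sub_mem_fil_iff.1 (show w + x - w ∈ F.fil N by simpa using hxN)
    exact this
  -- Translation by the zero `w` does not change `f`, so a double zero at `w` would make `f(π ^ N)`
  -- divisible by `π ^ (2 * N)`. As `f(π ^ N)` is `π ^ N * D(f)` up to a multiple of `π ^ (2 * N)`,
  -- this forces `π ^ N ∣ D(f)` for every `N`.
  have h1 : π ^ (N * 2) ∣ (f.onPoints (w + x)).val := by
    rw [pow_mul]
    exact (pow_dvd_pow_of_dvd (hπ.mem_maximalIdeal_pow.1 hd) 2).trans (hpe _ (w + x).mem)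
  rw [map_add, hw, _root_.zero_add, onPoints_val, hxv] at h1
  have hxm : π ^ N ∈ maximalIdeal O := hxv ▸ x.mem
  rw [psEval_eq_add_mul hxm, f.constantCoeff_series, _root_.zero_add, mul_comm N 2, two_mul, pow_add,
    mul_dvd_mul_iff_left (pow_ne_zero _ hπ.ne_zero)] at h1
  have h2 := dvd_psEval_sub_constantCoeff hxm
    (PowerSeries.mk fun i => PowerSeries.coeff (i + 1) f.series)
  have h3 := dvd_sub h1 h2
  rw [sub_sub_cancel] at h3
  simpa [linCoeff, ← PowerSeries.coeff_zero_eq_constantCoeff_apply] using h3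

/-- Each root in `K̄` of the Weierstrass polynomial is topologically nilpotent, hence a geometric
zero of `f`, hence rational. So the polynomial splits over `O`, with distinct roots because zeros
are simple, and its degree counts the kernel. -/
theorem card_ker_of_kernelRational {K : Type*} [Field K] [CharZero K] [Algebra O K]
    [IsFractionRing O K] (hπ : Irreducible π) {f : Hom F G} {d : ℕ}
    (hd : (f.series.map (residue O)).order = d) (hK : f.KernelRational K) :
    Nat.card f.onPoints.ker = d := by
  classical
  have hinjK : Function.Injective (algebraMap O K) := IsFractionRing.injective O K
  haveI : CharZero O := ⟨fun a b h =>
    Nat.cast_injective (R := K) (by simpa using congrArg (algebraMap O K) h)⟩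
  haveI : FaithfulSMul O (AlgebraicClosure K) := by
    rw [faithfulSMul_iff_algebraMap_injective,
      IsScalarTower.algebraMap_eq O K (AlgebraicClosure K)]
    exact (algebraMap K (AlgebraicClosure K)).injective.comp hinjK
  have hinj : Function.Injective (algebraMap O (AlgebraicClosure K)) :=
    FaithfulSMul.algebraMap_injective _ _
  have hf0 : f.series ≠ 0 := fun h0 => by simp [h0] at hd
  have hlin := linCoeff_ne_zero hπ hf0
  obtain ⟨P, u, hP, hdP, hu, e⟩ := PowerSeries.exists_weierstrass_of_order hd
  let S := integralClosure O (AlgebraicClosure K)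
  let J : Ideal S := (maximalIdeal O).map (algebraMap O S)
  -- The extension is integral, so `𝔪` does not generate the unit ideal upstairs; roots having a
  -- power in `J` are therefore nonunits.
  have hJ : J ≠ ⊤ := by
    intro htop
    have hinjS : Function.Injective (algebraMap O S) := fun a b hab =>
      hinj (congrArg Subtype.val hab)
    rw [Ideal.map_eq_top_iff (algebraMap O S) hinjS (algebraMap_isIntegral_iff.2 inferInstance)]
      at htop
    exact (maximalIdeal.isMaximal O).ne_top htop
  have hroot : ∀ x ∈ (P.map (algebraMap O (AlgebraicClosure K))).roots,
      x ∈ (algebraMap O (AlgebraicClosure K)).range := by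
    intro x hx
    rw [Polynomial.mem_roots (hP.monic.map _).ne_zero, Polynomial.IsRoot.def,
      Polynomial.eval_map_algebraMap] at hx
    let x' : S := ⟨x, P, hP.monic, hx⟩
    have hx' : Polynomial.aeval x' P = 0 := by
      apply Subtype.ext
      have := Polynomial.aeval_algHom_apply S.val x' P
      exact this.symm.trans hx
    have hpow : x' ^ d ∈ J :=
      hP.toIsWeaklyEisensteinAt.pow_natDegree_le_of_aeval_zero_of_monic_mem_map hx' hP.monic d
        (by rw [hP.monic.natDegree_map, hdP])
    have hnu : x' ∈ nonunits S := fun hxu => hJ (Ideal.eq_top_of_isUnit_mem _ hpow (hxu.pow d))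
    obtain ⟨y, -, hy⟩ := hK x' ⟨hnu, PowerSeries.hasSum_zero_of_aeval_eq_zero J e hx' hpow⟩
    exact ⟨y, congrArg Subtype.val hy⟩
  have hsplit : P.Splits :=
    Polynomial.Splits.of_splits_map_of_injective hinj (IsAlgClosed.splits _) hroot
  have hmem : ∀ y, P.eval y = 0 → y ∈ maximalIdeal O := fun y hy =>
    (Ideal.IsPrime.mem_of_pow_mem inferInstance d
      (hP.toIsWeaklyEisensteinAt.pow_natDegree_le_of_root_of_monic_mem hy hP.monic d hdP.le))
  have hnodup : P.roots.Nodup := by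
    rw [Multiset.nodup_iff_count_le_one]
    intro y
    by_contra! hlt
    rw [Polynomial.count_roots] at hlt
    have hdvd := (pow_dvd_pow (Polynomial.X - Polynomial.C y) (show 2 ≤ _ from hlt)).trans
      (Polynomial.pow_rootMultiplicity_dvd P y)
    have hy : P.eval y = 0 := by
      rw [← Polynomial.IsRoot.def, ← Polynomial.rootMultiplicity_pos hP.monic.ne_zero]
      omega
    exact not_sq_dvd_of_mem hπ hlin e (hmem y hy) hdvd
  obtain ⟨hfin, hle⟩ := finite_ker hd
  refine le_antisymm hle ?_
  let r : P.roots.toFinset → f.onPoints.ker := fun y =>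
    have hy : P.eval y.1 = 0 := (Polynomial.mem_roots'.1 (Multiset.mem_toFinset.1 y.2)).2
    ⟨⟨y.1, hmem _ hy⟩, (mem_ker_iff_eval hu e).2 hy⟩
  have hr : Function.Injective r := fun x y hxy =>
    Subtype.ext (congrArg (fun z : f.onPoints.ker => z.1.val) hxy)
  have := Nat.card_le_card_of_injective r hr
  rwa [Nat.card_eq_fintype_card, Fintype.card_coe, Multiset.toFinset_card_of_nodup hnodup,
    ← hsplit.natDegree_eq_card_roots, hdP] at this

end FormalGroup.Hom

/-! ### Artin–Schreier theory over a quasi-finite residue field -/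

section ArtinSchreier

theorem exists_zmod_cast_eq_of_pow_eq {L : Type*} [Field L] (p : ℕ) [Fact p.Prime] [CharP L p]
    {x : L} (hx : x ^ p = x) : ∃ n : ZMod p, ZMod.castHom dvd_rfl L n = x := by
  have h : x ∈ (⊥ : Subfield L) := (Subfield.mem_bot_iff_pow_eq_self L p).2 hx
  have hle : (⊥ : Subfield L) ≤ (ZMod.castHom (dvd_refl p) L).fieldRange := bot_le
  exact hle h

/-- Over a field of characteristic `p`, a Galois extension of degree `p` gives rise to an element
that is not of the form `x ^ p - x`. -/
theorem exists_not_mem_range_of_isGalois {k L : Type*} [Field k] [Field L] [Algebra k L] (p : ℕ)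
    [hp : Fact p.Prime] [CharP k p] [FiniteDimensional k L] [IsGalois k L]
    (hd : Module.finrank k L = p) : ∃ c : k, ∀ x : k, x ^ p - x ≠ c := by
  classical
  haveI : CharP L p := charP_of_injective_algebraMap (algebraMap k L).injective p
  have hcard : Nat.card (L ≃ₐ[k] L) = p := by rw [IsGalois.card_aut_eq_finrank, hd]
  let ε : (L ≃ₐ[k] L) ≃* Multiplicative (ZMod p) :=
    mulEquivOfPrimeCardEq (p := p) hcard (by simp)
  let χ : (L ≃ₐ[k] L) → L := fun g => ZMod.castHom (dvd_refl p) L (ε g).toAdd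
  have hχmul : ∀ g h, χ (g * h) = χ g + χ h := fun g h => by simp [χ]
  obtain ⟨θ, hθ⟩ := Algebra.trace_surjective k L 1
  have htr : ∑ g : L ≃ₐ[k] L, g θ = 1 := by
    rw [← trace_eq_sum_automorphisms, hθ, map_one]
  have hχfix : ∀ g h : L ≃ₐ[k] L, g (χ h) = χ h := fun g h => by
    have := RingHom.congr_fun (Subsingleton.elim
      ((g : L →+* L).comp (ZMod.castHom (dvd_refl p) L)) (ZMod.castHom (dvd_refl p) L))
      (ε h).toAdd
    exact this
  -- Additive Hilbert 90: with `θ` of trace `1`, this element satisfies `g α = α + χ g`, so `α ^ p -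
  -- α` is fixed by the group.
  set α : L := -∑ g : L ≃ₐ[k] L, χ g * g θ with hα
  have hact : ∀ g : L ≃ₐ[k] L, g α = α + χ g := fun g => by
    have h1 : g α = -∑ h : L ≃ₐ[k] L, (χ (g * h) - χ g) * (g * h) θ := by
      rw [hα, map_neg, map_sum]
      congr 1
      refine Finset.sum_congr rfl fun h _ => ?_
      rw [map_mul, hχfix, hχmul, add_sub_cancel_left]
      rfl
    have h2 : ∑ h : L ≃ₐ[k] L, (χ (g * h) - χ g) * (g * h) θ =
        ∑ h : L ≃ₐ[k] L, (χ h - χ g) * h θ :=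
      Equiv.sum_comp (Equiv.mulLeft g) fun h => (χ h - χ g) * h θ
    rw [h1, h2]
    simp only [sub_mul, Finset.sum_sub_distrib, ← Finset.mul_sum, htr, mul_one, hα]
    ring
  have hχp : ∀ g, χ g ^ p = χ g := fun g => by
    simp only [χ]
    rw [← map_pow, ZMod.pow_card]
  have hfix : ∀ g : L ≃ₐ[k] L, g (α ^ p - α) = α ^ p - α := fun g => by
    rw [map_sub, map_pow, hact, add_pow_char, hχp]
    ring
  obtain ⟨c, hc⟩ := (IsGalois.mem_range_algebraMap_iff_fixed (F := k) (α ^ p - α)).2 hfix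
  refine ⟨c, fun x hx => ?_⟩
  have h0 : (α - algebraMap k L x) ^ p = α - algebraMap k L x := by
    rw [sub_pow_char]
    have := congrArg (algebraMap k L) hx
    rw [hc, map_sub, map_pow] at this
    linear_combination -this
  obtain ⟨n, hn⟩ := exists_zmod_cast_eq_of_pow_eq p h0
  have hαk : α = algebraMap k L (x + ZMod.castHom (dvd_refl p) k n) := by
    have := RingHom.congr_fun (Subsingleton.elim
      ((algebraMap k L).comp (ZMod.castHom (dvd_refl p) k)) (ZMod.castHom (dvd_refl p) L)) n
    rw [RingHom.comp_apply] at this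
    rw [map_add, this, hn]
    ring
  have h1 := hact (ε.symm (Multiplicative.ofAdd 1))
  rw [hαk, AlgEquiv.commutes, left_eq_add] at h1
  simp [χ] at h1

/-- If the absolute Galois group of a perfect field `k` is topologically generated by one element
and `k` has a Galois extension of degree `p`, then `k / ℘ k` has order `p`. -/
theorem exists_artinSchreier_hom {k : Type*} [Field k] [PerfectField k] (p : ℕ)
    [hp : Fact p.Prime] [CharP k p] (σ : AlgebraicClosure k ≃ₐ[k] AlgebraicClosure k)
    (hσ : ∀ H : Subgroup (AlgebraicClosure k ≃ₐ[k] AlgebraicClosure k),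
      IsClosed (H : Set (AlgebraicClosure k ≃ₐ[k] AlgebraicClosure k)) → σ ∈ H → H = ⊤)
    (hne : ∃ c : k, ∀ x : k, x ^ p - x ≠ c) :
    ∃ χ : k →+ ZMod p, Function.Surjective χ ∧ ∀ c, χ c = 0 ↔ ∃ x : k, x ^ p - x = c := by
  classical
  let L := AlgebraicClosure k
  haveI : CharP L p := charP_of_injective_algebraMap (algebraMap k L).injective p
  let ι := ZMod.castHom (dvd_refl p) L
  have hι : Function.Injective ι := ι.injective
  have hσι : ∀ n, σ (ι n) = ι n := fun n =>
    RingHom.congr_fun (Subsingleton.elim ((σ : L →+* L).comp ι) ι) n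
  have hex : ∀ c : k, ∃ α : L, α ^ p - α = algebraMap k L c := fun c => by
    obtain ⟨α, hα⟩ := IsSepClosed.exists_root_C_mul_X_pow_add_C_mul_X_add_C' (k := L) p p 1 (-1)
      (-algebraMap k L c) dvd_rfl hp.out.two_le (by simp)
    exact ⟨α, by linear_combination hα⟩
  have hdiff : ∀ (c : k) (α : L), α ^ p - α = algebraMap k L c → ∃ n, ι n = σ α - α := by
    intro c α hα
    refine exists_zmod_cast_eq_of_pow_eq p ?_
    have h1 := congrArg σ hα
    rw [map_sub, map_pow, AlgEquiv.commutes] at h1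
    rw [sub_pow_char]
    linear_combination h1 - hα
  choose α hα using hex
  choose n hn using fun c => hdiff c (α c) (hα c)
  have huniq : ∀ (c : k) (β : L), β ^ p - β = algebraMap k L c → ι (n c) = σ β - β := by
    intro c β hβ
    have h1 : (β - α c) ^ p = β - α c := by
      rw [sub_pow_char]
      linear_combination hβ - hα c
    obtain ⟨r, hr⟩ := exists_zmod_cast_eq_of_pow_eq p h1
    have h2 := hσι r
    change σ (ZMod.castHom _ L r) = ZMod.castHom _ L r at h2
    rw [hr, map_sub] at h2
    rw [hn]
    linear_combination -h2
  -- The invariant of `c` is `σ α - α`, for any root `α` of `X ^ p - X - c`; it does not depend on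
  -- the root because two roots differ by a prime field element, fixed by `σ`.
  let χ : k →+ ZMod p := AddMonoidHom.mk' n fun c c' => hι (by
    rw [map_add, hn c, hn c', huniq (c + c') (α c + α c')]
    · rw [map_add]
      ring
    · rw [add_pow_char, map_add, ← hα, ← hα]
      ring)
  have hker : ∀ c, χ c = 0 ↔ ∃ x : k, x ^ p - x = c := by
    intro c
    constructor
    · intro h0
      have h1 : σ (α c) = α c := by
        rw [← sub_eq_zero, ← hn]
        change ι (χ c) = 0
        rw [h0, map_zero]
      -- The group fixing `k(α c)` is closed and contains the topological generator, so it is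
      -- everything and `α c` lies in `k`.
      have h2 := hσ (IntermediateField.adjoin k {α c}).fixingSubgroup
        (InfiniteGalois.fixingSubgroup_isClosed _) (by
          rw [IntermediateField.mem_fixingSubgroup_iff]
          intro x hx
          have hle : IntermediateField.adjoin k {α c} ≤
              IntermediateField.fixedField (Subgroup.zpowers σ) := by
            rw [IntermediateField.adjoin_simple_le_iff, IntermediateField.mem_fixedField_iff]
            rintro _ ⟨m, rfl⟩
            have : σ ∈ MulAction.stabilizer (L ≃ₐ[k] L) (α c) := h1
            exact (zpow_mem this m : _)
          exact (IntermediateField.mem_fixedField_iff _ _).1 (hle hx) σ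
            (Subgroup.mem_zpowers σ))
      have h3 : ∀ τ : L ≃ₐ[k] L, τ (α c) = α c := fun τ => by
        have : τ ∈ (IntermediateField.adjoin k {α c}).fixingSubgroup := h2 ▸ Subgroup.mem_top τ
        exact (IntermediateField.mem_fixingSubgroup_iff _ _).1 this _
          (IntermediateField.mem_adjoin_simple_self k _)
      obtain ⟨x, hx⟩ := (InfiniteGalois.mem_range_algebraMap_iff_fixed (α c)).2 h3
      refine ⟨x, (algebraMap k L).injective ?_⟩
      rw [map_sub, map_pow, hx, hα]
    · rintro ⟨x, rfl⟩
      refine hι ?_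
      change ι (n _) = _
      rw [huniq _ (algebraMap k L x) (by rw [map_sub, map_pow]), AlgEquiv.commutes, sub_self,
        map_zero]
  refine ⟨χ, ?_, hker⟩
  obtain ⟨c, hc⟩ := hne
  have hc0 : χ c ≠ 0 := fun h0 => by
    obtain ⟨x, hx⟩ := (hker c).1 h0
    exact hc x hx
  rw [← AddMonoidHom.range_eq_top]
  have hcz : Nat.card (ZMod p) = p := Nat.card_zmod p
  have := zmultiples_eq_top_of_prime_card hcz hc0
  rw [eq_top_iff, ← this, AddSubgroup.zmultiples_le]
  exact ⟨c, rfl⟩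

/-- The profinite completion of `ℤ` is topologically generated by the image of `1`. -/
theorem ProfiniteGrp.ProfiniteCompletion.eq_top_of_isClosed
    {H : Subgroup (completion (GrpCat.of (Multiplicative ℤ)))}
    (hH : IsClosed (H : Set (completion (GrpCat.of (Multiplicative ℤ)))))
    (h : etaFn (GrpCat.of (Multiplicative ℤ)) (Multiplicative.ofAdd (1 : ℤ)) ∈ H) : H = ⊤ := by
  have hr : Set.range (etaFn (GrpCat.of (Multiplicative ℤ))) ⊆
      (H : Set (completion (GrpCat.of (Multiplicative ℤ)))) := by
    rintro _ ⟨(n : Multiplicative ℤ), rfl⟩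
    have e : n = (Multiplicative.ofAdd (1 : ℤ)) ^ (Multiplicative.toAdd n) := by
      rw [← ofAdd_zsmul]
      simp
    have e' := map_zpow (eta (GrpCat.of (Multiplicative ℤ))).hom
      (Multiplicative.ofAdd (1 : ℤ)) (Multiplicative.toAdd n)
    rw [← e] at e'
    change etaFn (GrpCat.of (Multiplicative ℤ)) n =
      etaFn (GrpCat.of (Multiplicative ℤ)) (Multiplicative.ofAdd (1 : ℤ)) ^
        (Multiplicative.toAdd n) at e'
    rw [e']
    exact zpow_mem h _
  rw [eq_top_iff]
  intro x _
  have hx : x ∈ closure (Set.range (etaFn (GrpCat.of (Multiplicative ℤ)))) :=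
    denseRange (GrpCat.of (Multiplicative ℤ)) x
  exact (hH.closure_subset_iff.2 hr) hx

/-- The profinite completion of `ℤ` has an open normal subgroup of index `p`. -/
theorem ProfiniteGrp.ProfiniteCompletion.exists_continuous_surjective (p : ℕ) [NeZero p] :
    ∃ f : completion (GrpCat.of (Multiplicative ℤ)) →* Multiplicative (ZMod p),
      IsOpen (f.ker : Set (completion (GrpCat.of (Multiplicative ℤ)))) ∧
      Function.Surjective f := by
  letI : TopologicalSpace (Multiplicative (ZMod p)) := ⊥
  haveI : DiscreteTopology (Multiplicative (ZMod p)) := ⟨rfl⟩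
  let P : ProfiniteGrp.{0} := ProfiniteGrp.of (Multiplicative (ZMod p))
  let g₀ : Multiplicative ℤ →* Multiplicative (ZMod p) :=
    AddMonoidHom.toMultiplicative (Int.castAddHom (ZMod p))
  let g : GrpCat.of (Multiplicative ℤ) ⟶ GrpCat.of P := GrpCat.ofHom g₀
  refine ⟨(lift g).hom.toMonoidHom, ?_, ?_⟩
  · exact (isOpen_discrete ({1} : Set (Multiplicative (ZMod p)))).preimage
      (lift g).hom.continuous_toFun
  · intro x
    obtain ⟨m, hm⟩ := ZMod.intCast_surjective (Multiplicative.toAdd x)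
    refine ⟨etaFn _ (Multiplicative.ofAdd m), ?_⟩
    have := CategoryTheory.ConcreteCategory.congr_hom (lift_eta g) (Multiplicative.ofAdd m)
    refine Eq.trans this ?_
    change Multiplicative.ofAdd (m : ZMod p) = x
    rw [hm]
    rfl

/-- The generator `1` of the completed integers supplies the topological generator of the Galois
group, and an open normal subgroup of index `p` supplies a Galois extension of degree `p`. -/
theorem IsQuasiFiniteField.exists_artinSchreier_hom {k : Type*} [Field k]
    (hk : IsQuasiFiniteField k) (p : ℕ) [hp : Fact p.Prime] [CharP k p] :
    ∃ χ : k →+ ZMod p, Function.Surjective χ ∧ ∀ c, χ c = 0 ↔ ∃ x : k, x ^ p - x = c := by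
  obtain ⟨hperf, ⟨e⟩⟩ := hk
  let Γ := AlgebraicClosure k ≃ₐ[k] AlgebraicClosure k
  let Z := ProfiniteGrp.ProfiniteCompletion.completion (GrpCat.of (Multiplicative ℤ))
  let e' : Γ ≃ₜ* Z := e
  refine _root_.exists_artinSchreier_hom p
    (e'.symm (ProfiniteGrp.ProfiniteCompletion.etaFn _ (Multiplicative.ofAdd (1 : ℤ)))) ?_ ?_
  · intro H hH h1
    have h2 : H.comap (e'.symm.toMulEquiv.toMonoidHom) = ⊤ :=
      ProfiniteGrp.ProfiniteCompletion.eq_top_of_isClosed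
        (hH.preimage e'.symm.continuous_toFun) h1
    rw [eq_top_iff]
    intro x _
    have h3 : e' x ∈ H.comap (e'.symm.toMulEquiv.toMonoidHom) := h2 ▸ Subgroup.mem_top _
    have h4 : e'.symm (e' x) ∈ H := h3
    rwa [e'.symm_apply_apply] at h4
  · obtain ⟨f, hf, hfs⟩ := ProfiniteGrp.ProfiniteCompletion.exists_continuous_surjective p
    let g : Γ →* Multiplicative (ZMod p) := f.comp e'.toMulEquiv.toMonoidHom
    have hgo : IsOpen (g.ker : Set Γ) := hf.preimage e'.continuous_toFun
    have hgs : Function.Surjective g := hfs.comp e'.surjective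
    let H : ClosedSubgroup Γ := ⟨g.ker, Subgroup.isClosed_of_isOpen _ hgo⟩
    haveI : H.Normal := MonoidHom.normal_ker g
    let L := IntermediateField.fixedField (F := k) (E := AlgebraicClosure k) H.1
    have hL : L.fixingSubgroup = g.ker := InfiniteGalois.fixingSubgroup_fixedField H
    obtain ⟨hfd, hgal⟩ := (InfiniteGalois.isOpen_and_normal_iff_finite_and_isGalois L).1
      ⟨by rw [hL]; exact hgo, by rw [hL]; exact MonoidHom.normal_ker g⟩
    refine exists_not_mem_range_of_isGalois (L := L) p ?_
    rw [← IsGalois.card_aut_eq_finrank,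
      ← Nat.card_congr (InfiniteGalois.normalAutEquivQuotient H).toEquiv]
    change Nat.card (Γ ⧸ g.ker) = p
    rw [Nat.card_congr (QuotientGroup.quotientKerEquivOfSurjective g hgs).toEquiv]
    simp

variable {k : Type*} [Field k] (p : ℕ) [hp : Fact p.Prime] [CharP k p] {a b : k}

theorem addCartierInv_apply (x : k) : addCartierInv p a b x = a * x + b * x ^ p := rfl

theorem range_addCartierInv_eq_top [IsSepClosed k] (ha : a ≠ 0) :
    (addCartierInv p a b).range = ⊤ := by
  rw [AddMonoidHom.range_eq_top]
  intro c
  obtain ⟨x, hx⟩ := IsSepClosed.exists_root_C_mul_X_pow_add_C_mul_X_add_C' p p b a (-c) dvd_rfl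
    hp.out.two_le ha
  exact ⟨x, by rw [addCartierInv_apply]; linear_combination hx⟩

/-- Over a quasi-finite field, the cokernel of a map `x ↦ a x + b x ^ p` with nontrivial kernel
has order `p`. -/
theorem nonempty_quotient_range_addCartierInv_equiv (hk : IsQuasiFiniteField k) (hb : b ≠ 0)
    {ω : k} (hω : ω ≠ 0) (h : a * ω + b * ω ^ p = 0) :
    Nonempty (k ⧸ (addCartierInv p a b).range ≃+ ZMod p) := by
  obtain ⟨χ, hχ, hker⟩ := hk.exists_artinSchreier_hom p
  have hd : b * ω ^ p ≠ 0 := mul_ne_zero hb (pow_ne_zero _ hω)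
  -- Substituting `x = ω z` turns `a x + b x ^ p` into `b ω ^ p (z ^ p - z)`, since `a ω = -b ω ^
  -- p`.
  let χ' : k →+ ZMod p := χ.comp (AddMonoidHom.mulLeft (b * ω ^ p)⁻¹)
  have hs : Function.Surjective χ' := fun n => by
    obtain ⟨c, rfl⟩ := hχ n
    exact ⟨b * ω ^ p * c, congrArg χ (inv_mul_cancel_left₀ hd c)⟩
  have hk' : χ'.ker = (addCartierInv p a b).range := by
    ext c
    have h1 : χ' c = 0 ↔ ∃ x : k, x ^ p - x = (b * ω ^ p)⁻¹ * c := hker _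
    rw [AddMonoidHom.mem_ker, h1, AddMonoidHom.mem_range]
    constructor
    · rintro ⟨x, hx⟩
      refine ⟨ω * x, ?_⟩
      rw [addCartierInv_apply, ← mul_inv_cancel_left₀ hd c, ← hx, mul_pow]
      linear_combination x * h
    · rintro ⟨y, hy⟩
      refine ⟨ω⁻¹ * y, ?_⟩
      rw [← hy, addCartierInv_apply, eq_inv_mul_iff_mul_eq₀ hd]
      have h2 : y = ω * (ω⁻¹ * y) := (mul_inv_cancel_left₀ hω y).symm
      generalize ω⁻¹ * y = z at h2
      rw [h2, mul_pow]
      linear_combination -z * h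
  exact ⟨(QuotientAddGroup.quotientAddEquivOfEq hk'.symm).trans
    (QuotientAddGroup.quotientKerEquivOfSurjective χ' hs)⟩

end ArtinSchreier

/-! ### Chains of isogenies: kernels and valuations -/

theorem AddMonoidHom.card_ker_comp_eq_mul {A B C : Type*} [AddCommGroup A] [AddCommGroup B]
    [AddCommGroup C] (f : B →+ C) (g : A →+ B) :
    Nat.card (f.comp g).ker = Nat.card g.ker * Nat.card ((f.comp g).ker.map g) := by
  have hle : g.ker ≤ (f.comp g).ker := fun x hx => by
    rw [AddMonoidHom.mem_ker] at hx ⊢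
    rw [AddMonoidHom.comp_apply, hx, map_zero]
  rw [← AddSubgroup.relIndex_ker, ← Nat.card_congr (AddSubgroup.addSubgroupOfEquivOfLe hle).toEquiv]
  exact (AddSubgroup.card_mul_index _).symm

/-- If the kernel of a composite is as large as bounds on the kernels of the factors allow, then
these bounds are attained and the kernel of the outer map lies in the image of the inner one. -/
theorem AddMonoidHom.card_ker_of_card_ker_comp {A B C : Type*} [AddCommGroup A] [AddCommGroup B]
    [AddCommGroup C] (f : B →+ C) (g : A →+ B) [Finite f.ker] {d e : ℕ} (hde : 0 < d * e)
    (h : Nat.card (f.comp g).ker = d * e) (hf : Nat.card f.ker ≤ d) (hg : Nat.card g.ker ≤ e) :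
    Nat.card f.ker = d ∧ Nat.card g.ker = e ∧ (f.comp g).ker.map g = f.ker := by
  have hle : (f.comp g).ker.map g ≤ f.ker := by
    rintro _ ⟨x, hx, rfl⟩
    exact hx
  have h1 := card_ker_comp_eq_mul f g
  have h2 : Nat.card ((f.comp g).ker.map g) ≤ Nat.card f.ker :=
    Nat.card_le_card_of_injective _ (AddSubgroup.inclusion_injective hle)
  have hd : 0 < d := Nat.pos_of_mul_pos_right hde
  have he : 0 < e := Nat.pos_of_mul_pos_left hde
  rw [h] at h1
  have h3 : Nat.card ((f.comp g).ker.map g) = d := by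
    refine le_antisymm (h2.trans hf) ?_
    by_contra! hlt
    have h4 : Nat.card g.ker * Nat.card ((f.comp g).ker.map g) < e * d :=
      lt_of_le_of_lt (Nat.mul_le_mul_right _ hg) (Nat.mul_lt_mul_of_pos_left hlt he)
    rw [← h1, mul_comm e] at h4
    exact lt_irrefl _ h4
  have h4 : Nat.card f.ker = d := le_antisymm hf (h3 ▸ h2)
  refine ⟨h4, ?_, AddSubgroup.eq_of_le_of_card_ge hle (by rw [h3, h4])⟩
  rw [h3, mul_comm d] at h1
  exact (Nat.eq_of_mul_eq_mul_right hd h1).symm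

namespace FormalGroup

section ChainComp

variable {R : Type*} [CommRing R] {n : ℕ} {G : Fin (n + 1) → FormalGroup R}
  (φ : ∀ i : Fin n, Hom (G i.succ) (G i.castSucc))

theorem chainComp_last : chainComp φ (Fin.last n) = Hom.id _ := by
  rw [chainComp, Fin.reverseInduction_last]

theorem chainComp_castSucc (i : Fin n) :
    chainComp φ i.castSucc = (φ i).comp (chainComp φ i.succ) := by
  rw [chainComp, Fin.reverseInduction_castSucc]
  rfl

end ChainComp

variable {O : Type*} [CommRing O] [IsDomain O] [IsDiscreteValuationRing O]
  [IsAdicComplete (maximalIdeal O) O] {π : O} {p : ℕ} [hp : Fact p.Prime]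
  {n : ℕ} {G : Fin (n + 1) → FormalGroup O} [∀ i, (G i).IsComm]
  {φ : ∀ i : Fin n, Hom (G i.succ) (G i.castSucc)}

theorem order_chainComp (hφ : ∀ i, (φ i).HasHeight p 1) (j : Fin (n + 1)) :
    ((chainComp φ j).series.map (residue O)).order = (p ^ (n - (j : ℕ)) : ℕ) := by
  induction j using Fin.reverseInduction with
  | last =>
    rw [chainComp_last]
    change (PowerSeries.map (residue O) PowerSeries.X).order = _
    simp
  | cast i ih =>
    rw [chainComp_castSucc, Hom.order_comp ((hφ i).order hp.out.ne_zero) ih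
      (pow_ne_zero _ hp.out.ne_zero), ← pow_succ']
    congr 2
    simp only [Fin.val_succ, Fin.val_castSucc]
    omega

/-- The information on a chain of isogenies of height one with cyclic rational kernel from which
the cokernel of the composite is computed. -/
structure ChainProfile (π : O) (p : ℕ) (φ : ∀ i : Fin n, Hom (G i.succ) (G i.castSucc))
    (s : Fin n → ℕ) (a b : Fin n → O) : Prop where
  profile : ∀ i, (φ i).Profile π p (s i) (a i) (b i)
  ker_le : ∀ i, (φ i).onPoints.ker ≤ (chainComp φ i.succ).onPoints.range
  card_ker : ∀ j : Fin (n + 1), Nat.card (chainComp φ j).onPoints.ker = p ^ (n - (j : ℕ))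
  exists_lift : ∀ i, ∃ w, (chainComp φ i.succ).onPoints w ∈ (φ i).onPoints.ker ∧
    p • w ∈ (chainComp φ i.succ).onPoints.ker ∧
    p ^ (n - (i.succ : ℕ)) • w ≠ 0 ∧
    ∃ ω, IsUnit ω ∧ ((chainComp φ i.succ).onPoints w).val = π ^ s i * ω

/-- The full composite has `p ^ n` rational zeros. Splitting off one isogeny at a time, the bounds
`p` for it and the power of `p` for the rest must be attained, so each kernel is fully rational and
is the image of the kernel of a longer composite. -/
theorem exists_chainProfile {K : Type*} [Field K] [CharZero K] [Algebra O K] [IsFractionRing O K]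
    [CharP (ResidueField O) p] (hπ : Irreducible π) (hφ : ∀ i, (φ i).HasHeight p 1)
    (hK : (chainComp φ 0).KernelRational K) (hcyc : IsAddCyclic (chainComp φ 0).onPoints.ker) :
    ∃ s a b, ChainProfile π p φ s a b := by
  have hord := order_chainComp hφ
  have hcnt : ∀ i : Fin n,
      Nat.card (chainComp φ i.castSucc).onPoints.ker = p ^ (n - (i.castSucc : ℕ)) →
      Nat.card (φ i).onPoints.ker = p ∧
      Nat.card (chainComp φ i.succ).onPoints.ker = p ^ (n - (i.succ : ℕ)) ∧
      (chainComp φ i.castSucc).onPoints.ker.map (chainComp φ i.succ).onPoints =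
        (φ i).onPoints.ker := by
    intro i hi
    obtain ⟨hfin, hle⟩ := Hom.finite_ker ((hφ i).order hp.out.ne_zero)
    have e : n - (i.castSucc : ℕ) = n - (i.succ : ℕ) + 1 := by
      simp only [Fin.val_succ, Fin.val_castSucc]
      omega
    rw [e, pow_succ'] at hi
    rw [chainComp_castSucc, Hom.onPoints_comp] at hi ⊢
    exact AddMonoidHom.card_ker_of_card_ker_comp _ _
      (Nat.mul_pos hp.out.pos (pow_pos hp.out.pos _)) hi hle (Hom.finite_ker (hord i.succ)).2
  have hcard : ∀ j : Fin (n + 1),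
      Nat.card (chainComp φ j).onPoints.ker = p ^ (n - (j : ℕ)) := by
    intro j
    induction j using Fin.induction with
    | zero => exact Hom.card_ker_of_kernelRational hπ (hord 0) hK
    | succ i ih => exact (hcnt i ih).2.1
  have hle : ∀ j : Fin (n + 1), (chainComp φ j).onPoints.ker ≤ (chainComp φ 0).onPoints.ker := by
    intro j
    induction j using Fin.induction with
    | zero => exact le_rfl
    | succ i ih =>
      refine le_trans (fun x hx => ?_) ih
      rw [AddMonoidHom.mem_ker] at hx ⊢
      rw [chainComp_castSucc, Hom.onPoints_comp, AddMonoidHom.comp_apply, hx, map_zero]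
  choose s a b hprof using fun i =>
    Hom.exists_profile hπ ((hφ i).order hp.out.ne_zero) (hcnt i (hcard _)).1
  refine ⟨s, a, b, hprof, fun i => ?_, hcard, fun i => ?_⟩
  · rw [← (hcnt i (hcard _)).2.2]
    rintro _ ⟨x, -, rfl⟩
    exact ⟨x, rfl⟩
  · have hc : IsAddCyclic (chainComp φ i.castSucc).onPoints.ker :=
      isAddCyclic_of_injective (AddSubgroup.inclusion (hle i.castSucc))
        (AddSubgroup.inclusion_injective _)
    -- The lift is a generator of the kernel of the composite starting one step earlier; its order
    -- is exactly one factor `p` too large for it to be killed by the tail.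
    obtain ⟨⟨w, hw⟩, hgen⟩ := hc.exists_generator
    have ho := addOrderOf_eq_card_of_forall_mem_zmultiples hgen
    rw [hcard, AddSubgroup.addOrderOf_mk] at ho
    have hwk : (chainComp φ i.succ).onPoints w ∈ (φ i).onPoints.ker := by
      rw [← (hcnt i (hcard _)).2.2]
      exact ⟨w, hw, rfl⟩
    have hne : p ^ (n - (i.succ : ℕ)) • w ≠ 0 := fun h0 => by
      have hdvd := addOrderOf_dvd_of_nsmul_eq_zero h0
      rw [ho, Nat.pow_dvd_pow_iff_le_right hp.out.one_lt] at hdvd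
      simp only [Fin.val_succ, Fin.val_castSucc] at hdvd
      omega
    have hw0 : (chainComp φ i.succ).onPoints w ≠ 0 := fun h0 => by
      refine hne ?_
      have := card_nsmul_eq_zero' (x := (⟨w, h0⟩ : (chainComp φ i.succ).onPoints.ker))
      rw [hcard] at this
      exact congrArg Subtype.val this
    refine ⟨w, hwk, ?_, hne, (hprof i).ker_val _ hwk hw0⟩
    rw [AddMonoidHom.mem_ker, map_nsmul]
    have := card_nsmul_eq_zero' (x := (⟨_, hwk⟩ : (φ i).onPoints.ker))
    rw [(hcnt i (hcard _)).1] at this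
    exact congrArg Subtype.val this

namespace ChainProfile

variable {s : Fin n → ℕ} {a b : Fin n → O}

/-- Let `y` be the image of `w` one step before `G_j`. Then `p • y` is in the kernel of the next
isogeny, and it is nonzero, since otherwise `p • w` would lie in a kernel of order too small for the
order of `w`. -/
theorem val_lt_of_eq_castSucc [CharP (ResidueField O) p] (hπ : Irreducible π)
    (h : ChainProfile π p φ s a b) {j : Fin (n + 1)} {w : (G (Fin.last n)).Points}
    (hw : p • w ∈ (chainComp φ j).onPoints.ker) (hw' : p ^ (n - (j : ℕ)) • w ≠ 0) {t : ℕ} {ω : O}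
    (hω : IsUnit ω) (hval : ((chainComp φ j).onPoints w).val = π ^ t * ω) (i : Fin n)
    (hi : j = i.castSucc) : t < p * s i := by
  subst hi
  rw [chainComp_castSucc, Hom.onPoints_comp] at hw hval
  refine (h.profile i).val_lt_of_prime_nsmul hπ (y := (chainComp φ i.succ).onPoints w) ?_ ?_
    hω hval
  · intro h0
    rw [← map_nsmul] at h0
    refine hw' ?_
    have := card_nsmul_eq_zero' (x := (⟨p • w, h0⟩ : (chainComp φ i.succ).onPoints.ker))
    rw [h.card_ker] at this
    have h1 : p ^ (n - (i.succ : ℕ)) • p • w = 0 := congrArg Subtype.val this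
    rw [← mul_smul, ← pow_succ] at h1
    convert h1 using 3
    simp only [Fin.val_succ, Fin.val_castSucc]
    omega
  · rw [← map_nsmul]
    exact hw

/-- The decisive use of cyclicity: a nonzero kernel point of one isogeny, of valuation `s i`, is an
image to which the previous bound applies. -/
theorem lt_mul_of_succ_eq_castSucc [CharP (ResidueField O) p] (hπ : Irreducible π)
    (h : ChainProfile π p φ s a b) {i i' : Fin n} (hi : i.succ = i'.castSucc) : s i < p * s i' := by
  obtain ⟨w, -, h1, h2, ω, hω, hval⟩ := h.exists_lift i
  exact h.val_lt_of_eq_castSucc hπ h1 h2 hω hval i' hi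

/-- Start at `G_n`, where the identity gives all of `k` in every positive degree. Each isogeny
applied below its break multiplies degrees by `p` and sends `x` to `b x ^ p`, which is onto because
`k` is perfect. The bound on `r` is vacuous at the last index. -/
theorem leadGroup_of_lt [CharP (ResidueField O) p] [PerfectField (ResidueField O)]
    (hπ : Irreducible π) (h : ChainProfile π p φ s a b) (j : Fin (n + 1)) :
    ∀ r : ℕ, r ≠ 0 → (∀ i, j = i.castSucc → r < p * s i) →
      (p ^ (n - (j : ℕ)) ∣ r → (chainComp φ j).leadGroup hπ r = ⊤) ∧
      (¬ p ^ (n - (j : ℕ)) ∣ r → (chainComp φ j).leadGroup hπ r = ⊥) := by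
  induction j using Fin.reverseInduction with
  | last =>
    intro r hr _
    refine ⟨fun _ => ?_, fun hn => absurd ?_ hn⟩
    · rw [chainComp_last, eq_top_iff]
      intro c _
      obtain ⟨ξ, rfl⟩ := residue_surjective c
      refine Hom.mem_leadGroup.2 ⟨Points.powMul hπ _ hr ξ, ξ, ?_, rfl⟩
      rw [Hom.onPoints_id]
      rfl
    · simp
  | cast i ih =>
    intro r hr hlt
    have e : n - (i.castSucc : ℕ) = n - (i.succ : ℕ) + 1 := by
      simp only [Fin.val_succ, Fin.val_castSucc]
      omega
    have hrs := hlt i rfl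
    -- Being below the break here means `r' < s i`, and `s i` is itself below the next break.
    have hbound : ∀ r', r = p * r' → ∀ i', i.succ = i'.castSucc → r' < p * s i' := by
      rintro r' rfl i' hi'
      exact (Nat.lt_of_mul_lt_mul_left hrs).trans (h.lt_mul_of_succ_eq_castSucc hπ hi')
    rw [e, pow_succ', chainComp_castSucc]
    constructor
    · rintro ⟨q, rfl⟩
      rw [mul_assoc] at hr hrs ⊢
      have hr' : p ^ (n - (i.succ : ℕ)) * q ≠ 0 := right_ne_zero_of_mul hr
      have htop := (ih _ hr' (hbound _ (mul_assoc _ _ _))).1 (dvd_mul_right _ _)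
      rw [eq_top_iff]
      intro c _
      rcases eq_or_ne c 0 with rfl | hc0
      · exact zero_mem _
      rw [(h.profile i).leadGroup_low hπ _ hrs hc0]
      obtain ⟨x, hx⟩ := surjective_frobenius (ResidueField O) p ((residue O (b i))⁻¹ * c)
      refine ⟨_, rfl, hr', x, htop ▸ AddSubgroup.mem_top x, ?_⟩
      rw [frobenius_def] at hx
      rw [hx, mul_inv_cancel_left₀ (h.profile i).residue_top_ne_zero]
    · intro hnd
      rw [eq_bot_iff]
      intro c hc
      by_contra hc0
      obtain ⟨r', rfl, hr', x, hx, hcx⟩ := ((h.profile i).leadGroup_low hπ _ hrs hc0).1 hc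
      rw [(ih r' hr' (hbound r' rfl)).2 fun hd => hnd (Nat.mul_dvd_mul_left p hd),
        AddSubgroup.mem_bot] at hx
      rw [hx, zero_pow hp.out.ne_zero, mul_zero] at hcx
      exact hc0 hcx

/-- A nonzero point of the kernel lies in the image of the tail and has a nonzero leading
coefficient in degree `s i`, which is below the tail's first break. -/
theorem pow_dvd [CharP (ResidueField O) p] [PerfectField (ResidueField O)] (hπ : Irreducible π)
    (h : ChainProfile π p φ s a b) (i : Fin n) : p ^ (n - (i.succ : ℕ)) ∣ s i := by
  by_contra hnd
  obtain ⟨w, -, -, -, ω, hω, hval⟩ := h.exists_lift i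
  have hbot := (h.leadGroup_of_lt hπ i.succ (s i) (h.profile i).ne_zero
    fun i' hi' => h.lt_mul_of_succ_eq_castSucc hπ hi').2 hnd
  have hmem : residue O ω ∈ (chainComp φ i.succ).leadGroup hπ (s i) :=
    Hom.mem_leadGroup.2 ⟨w, ω, hval, rfl⟩
  rw [hbot, AddSubgroup.mem_bot] at hmem
  exact isUnit_iff_residue_ne_zero.1 hω hmem

theorem leadGroup_mul [CharP (ResidueField O) p] [PerfectField (ResidueField O)]
    (hπ : Irreducible π) (h : ChainProfile π p φ s a b) (i : Fin n) :
    (chainComp φ i.castSucc).leadGroup hπ (p * s i) =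
      (addCartierInv p (residue O (a i)) (residue O (b i))).range := by
  have htop := (h.leadGroup_of_lt hπ i.succ (s i) (h.profile i).ne_zero
    fun i' hi' => h.lt_mul_of_succ_eq_castSucc hπ hi').1 (h.pow_dvd hπ i)
  ext c
  rw [chainComp_castSucc, (h.profile i).leadGroup_mid hπ, htop]
  simp only [AddSubgroup.mem_top, true_and, AddMonoidHom.mem_range, addCartierInv_apply]
  exact exists_congr fun x => eq_comm

/-- The leading coefficient of a nonzero kernel point is such a zero; over a quasi-finite field it
puts the map in Artin–Schreier form. -/
theorem exists_zero_addCartierInv (hπ : Irreducible π) (h : ChainProfile π p φ s a b) (i : Fin n) :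
    ∃ ω : ResidueField O, ω ≠ 0 ∧ residue O (a i) * ω + residue O (b i) * ω ^ p = 0 := by
  obtain ⟨w, hw, -, -, ω, hω, hval⟩ := h.exists_lift i
  refine ⟨residue O ω, isUnit_iff_residue_ne_zero.1 hω, ?_⟩
  obtain ⟨η, h1, h2⟩ := (h.profile i).mid ω
  rw [← hval, ← Hom.onPoints_val, (AddMonoidHom.mem_ker).1 hw, Points.val_zero, eq_comm,
    mul_eq_zero, or_iff_right (pow_ne_zero _ hπ.ne_zero)] at h1
  rw [← h2, h1, map_zero]

theorem nonempty_gr_equiv_gr (hπ : Irreducible π) (h : ChainProfile π p φ s a b) (i : Fin n)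
    {r : ℕ} (hr : s i < r) :
    Nonempty ((chainComp φ i.castSucc).gr (r + (p - 1) * s i) ≃+ (chainComp φ i.succ).gr r) := by
  rw [chainComp_castSucc]
  exact Hom.nonempty_gr_equiv_gr hπ _ _ (by omega) (by omega) (h.profile i).residue_lin_ne_zero
    ((h.profile i).leadGroup_high hπ _ (h.ker_le i) hr)

theorem chainT_eq (hπ : Irreducible π) (h : ChainProfile π p φ s a b) (i : Fin n) :
    chainT φ i = (p - 1) * s i := by
  rw [chainT, (h.profile i).linCoeff_eq, hπ.addVal_pow_mul (h.profile i).isUnit_lin]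

end ChainProfile

end FormalGroup

/-! ### The breaks and the reduction to tails of the chain -/

namespace FormalGroup

variable {O : Type*} [CommRing O] [IsDomain O] [IsDiscreteValuationRing O]
  {n : ℕ} {G : Fin (n + 1) → FormalGroup O}

/-- The sum `t_1 + ⋯ + t_j`. -/
def chainSum (φ : ∀ i : Fin n, Hom (G i.succ) (G i.castSucc)) (j : Fin (n + 1)) : ℕ :=
  ∑ l with l.castSucc < j, chainT φ l

theorem chainSum_zero (φ : ∀ i : Fin n, Hom (G i.succ) (G i.castSucc)) : chainSum φ 0 = 0 := by
  simp [chainSum]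

theorem chainSum_castSucc (φ : ∀ i : Fin n, Hom (G i.succ) (G i.castSucc)) (i : Fin n) :
    chainSum φ i.castSucc = ∑ l ∈ Finset.Iio i, chainT φ l := by
  refine Finset.sum_congr ?_ fun _ _ => rfl
  ext l
  simp

theorem chainSum_succ_eq_sum (φ : ∀ i : Fin n, Hom (G i.succ) (G i.castSucc)) (i : Fin n) :
    chainSum φ i.succ = ∑ l ∈ Finset.Iic i, chainT φ l := by
  refine Finset.sum_congr ?_ fun _ _ => rfl
  ext l
  simp [Fin.castSucc_lt_succ_iff]

theorem chainSum_succ (φ : ∀ i : Fin n, Hom (G i.succ) (G i.castSucc)) (i : Fin n) :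
    chainSum φ i.succ = chainSum φ i.castSucc + chainT φ i := by
  rw [chainSum_succ_eq_sum, chainSum_castSucc, ← Finset.Iio_insert,
    Finset.sum_insert Finset.notMem_Iio_self, add_comm]

/-- The integers `c_0 = 0` and `c_{i+1} = t_1 + ⋯ + t_{i+1} + s_{i+1}`. -/
def chainBreak (φ : ∀ i : Fin n, Hom (G i.succ) (G i.castSucc)) (s : Fin n → ℕ)
    (j : Fin (n + 1)) : ℕ :=
  Fin.cases 0 (fun i => chainSum φ i.succ + s i) j

namespace ChainProfile

variable [IsAdicComplete (maximalIdeal O) O] {π : O} {p : ℕ} [hp : Fact p.Prime]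
  [∀ i, (G i).IsComm] {φ : ∀ i : Fin n, Hom (G i.succ) (G i.castSucc)}
  {s : Fin n → ℕ} {a b : Fin n → O}

theorem chainT_div (hπ : Irreducible π) (h : ChainProfile π p φ s a b) (i : Fin n) :
    (chainT φ i : ℚ) / ((p : ℚ) - 1) = s i := by
  have h1 : (p : ℚ) - 1 ≠ 0 := by
    rw [sub_ne_zero]
    exact_mod_cast hp.out.one_lt.ne'
  rw [h.chainT_eq hπ, Nat.cast_mul, Nat.cast_sub hp.out.one_lt.le, Nat.cast_one,
    mul_div_cancel_left₀ _ h1]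

theorem chainC_eq (hπ : Irreducible π) (h : ChainProfile π p φ s a b) (j : Fin (n + 1)) :
    chainC p φ j = chainBreak φ s j := by
  refine Fin.cases ?_ (fun i => ?_) j
  · simp [chainC, chainBreak]
  · simp only [chainC, chainBreak, Fin.cases_succ]
    rw [h.chainT_div hπ, chainSum_succ_eq_sum]
    push_cast
    rfl

theorem mul_eq_chainT_add (hπ : Irreducible π) (h : ChainProfile π p φ s a b) (i : Fin n) :
    p * s i = chainT φ i + s i := by
  rw [h.chainT_eq hπ, Hom.Profile.mul_add_mul_eq, add_comm]

theorem chainBreak_succ (hπ : Irreducible π) (h : ChainProfile π p φ s a b) (i : Fin n) :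
    chainBreak φ s i.succ = chainSum φ i.castSucc + p * s i := by
  rw [h.mul_eq_chainT_add hπ, ← add_assoc, ← chainSum_succ]
  rfl

/-- Consecutive breaks share the partial sum of the `t`'s and differ by `p * s i - s l`, with `l`
the index preceding `i`. -/
theorem strictMono_chainBreak [CharP (ResidueField O) p] (hπ : Irreducible π)
    (h : ChainProfile π p φ s a b) : StrictMono (chainBreak φ s) := by
  refine Fin.strictMono_iff_lt_succ.2 fun i => ?_
  rw [h.chainBreak_succ hπ]
  rcases Fin.eq_zero_or_eq_succ i.castSucc with h0 | ⟨l, hl⟩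
  · rw [h0]
    have : 0 < p * s i := Nat.mul_pos hp.out.pos (Nat.pos_of_ne_zero (h.profile i).ne_zero)
    change 0 < _
    omega
  · rw [hl]
    have := h.lt_mul_of_succ_eq_castSucc hπ hl.symm
    change chainSum φ l.succ + s l < _
    omega

theorem pow_dvd_chainSum [CharP (ResidueField O) p] [PerfectField (ResidueField O)]
    (hπ : Irreducible π) (h : ChainProfile π p φ s a b) (i : Fin n) :
    p ^ (n - (i : ℕ)) ∣ chainSum φ i.castSucc := by
  rw [chainSum_castSucc]
  refine Finset.dvd_sum fun l hl => ?_
  rw [h.chainT_eq hπ]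
  have hli : (l : ℕ) < i := Fin.lt_def.1 (Finset.mem_Iio.1 hl)
  refine Dvd.dvd.mul_left ((pow_dvd_pow p ?_).trans (h.pow_dvd hπ l)) _
  rw [Fin.val_succ]
  omega

/-- Above the `j`-th break, the graded pieces of the composite are those of its `j`-th tail. -/
theorem exists_gr_equiv [CharP (ResidueField O) p] (hπ : Irreducible π)
    (h : ChainProfile π p φ s a b) (j : Fin (n + 1)) :
    ∀ m, chainBreak φ s j < m → ∃ r, r ≠ 0 ∧ m = chainSum φ j + r ∧
      Nonempty ((chainComp φ 0).gr m ≃+ (chainComp φ j).gr r) := by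
  induction j using Fin.induction with
  | zero =>
    intro m hm
    refine ⟨m, ?_, by rw [chainSum_zero, _root_.zero_add], ⟨AddEquiv.refl _⟩⟩
    have : 0 < m := hm
    omega
  | succ i ih =>
    intro m hm
    obtain ⟨r, hr, rfl, ⟨e⟩⟩ := ih m ((h.strictMono_chainBreak hπ i.castSucc_lt_succ).trans hm)
    rw [h.chainBreak_succ hπ, h.mul_eq_chainT_add hπ] at hm
    obtain ⟨r', rfl⟩ : ∃ r', r = r' + chainT φ i := ⟨r - chainT φ i, by omega⟩
    have hr' : s i < r' := by omega
    obtain ⟨e'⟩ := h.nonempty_gr_equiv_gr hπ i hr'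
    rw [← h.chainT_eq hπ] at e'
    exact ⟨r', by omega, by rw [chainSum_succ]; omega, ⟨e.trans e'⟩⟩

/-- Beyond the last break a point lies beyond every break, so it can be lifted through the isogenies
one by one, each lift losing `t` in depth and staying above the next threshold, until `G_n` is
reached. -/
theorem fil_le_range [CharP (ResidueField O) p] (hπ : Irreducible π)
    (h : ChainProfile π p φ s a b) (j : Fin (n + 1)) :
    ∀ r, chainBreak φ s (Fin.last n) < chainSum φ j + r →
      (G j).fil r ≤ (chainComp φ j).onPoints.range := by
  induction j using Fin.reverseInduction with
  | last =>
    intro r _ z _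
    rw [chainComp_last, Hom.onPoints_id]
    exact ⟨z, rfl⟩
  | cast i ih =>
    intro r hr z hz
    have h1 := (h.strictMono_chainBreak hπ).monotone (Fin.le_last i.succ)
    rw [h.chainBreak_succ hπ, h.mul_eq_chainT_add hπ] at h1
    obtain ⟨r', rfl⟩ : ∃ r', r = r' + chainT φ i := ⟨r - chainT φ i, by omega⟩
    have hr' : s i < r' := by omega
    rw [h.chainT_eq hπ] at hz
    obtain ⟨x, hx, rfl⟩ := (h.profile i).exists_onPoints_eq hπ hr' hz
    obtain ⟨y, rfl⟩ := ih r' (by rw [chainSum_succ]; omega) hx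
    refine ⟨y, ?_⟩
    rw [chainComp_castSucc, Hom.onPoints_comp]
    rfl

end ChainProfile

end FormalGroup

end

/-! ### Assembly of the three statements -/

theorem proposition2p8 {O K : Type*} [CommRing O] [IsDomain O] [IsDiscreteValuationRing O]
    [IsAdicComplete (IsLocalRing.maximalIdeal O) O]
    [Field K] [CharZero K] [Algebra O K] [IsFractionRing O K]
    (p : ℕ) [Fact p.Prime] [CharP (IsLocalRing.ResidueField O) p]
    [PerfectField (IsLocalRing.ResidueField O)]
    (π : O) (hπ : Irreducible π)
    {n : ℕ} (hn : 1 ≤ n)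
    -- `F = G (Fin.last n)`, and `φ i : G_{i+1} → G_i` is the isogeny `φ_{i+1}`
    (G : Fin (n + 1) → FormalGroup O) [∀ i, (G i).IsComm]
    (φ : ∀ i : Fin n, FormalGroup.Hom (G i.succ) (G i.castSucc))
    (hφ : ∀ i, (φ i).HasHeight p 1)
    (hK : (FormalGroup.chainComp φ 0).KernelRational K)
    (hcyc : IsAddCyclic (FormalGroup.chainComp φ 0).onPoints.ker) :
    -- (i)
    (∀ (i : Fin n) (m : ℕ),
      FormalGroup.chainC p φ i.castSucc < m → (m : ℚ) < FormalGroup.chainC p φ i.succ →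
        (∃ r : ℕ, m = (∑ l ∈ Finset.Iio i, FormalGroup.chainT φ l) + r ∧
          Nonempty ((FormalGroup.chainComp φ 0).gr m ≃+
            (FormalGroup.chainComp φ i.castSucc).gr r)) ∧
        (¬ p ^ (n - (i : ℕ)) ∣ m →
          Nonempty ((FormalGroup.chainComp φ 0).gr m ≃+ IsLocalRing.ResidueField O)) ∧
        (p ^ (n - (i : ℕ)) ∣ m → Subsingleton ((FormalGroup.chainComp φ 0).gr m))) ∧
    -- (ii)
    (∀ i : Fin n, ∃ m r : ℕ,
      (m : ℚ) = FormalGroup.chainC p φ i.succ ∧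
      (r : ℚ) = p * FormalGroup.chainT φ i / ((p : ℚ) - 1) ∧
      Nonempty ((FormalGroup.chainComp φ 0).gr m ≃+
        (FormalGroup.chainComp φ i.castSucc).gr r) ∧
      (∃ u : O, (φ i).linCoeff = u * π ^ FormalGroup.chainT φ i ∧
        Nonempty ((FormalGroup.chainComp φ 0).gr m ≃+
          IsLocalRing.ResidueField O ⧸
            (addCartierInv p (IsLocalRing.residue O u)
              (IsLocalRing.residue O (PowerSeries.coeff p (φ i).series))).range)) ∧
      (IsSepClosed (IsLocalRing.ResidueField O) →
        Subsingleton ((FormalGroup.chainComp φ 0).gr m)) ∧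
      (IsQuasiFiniteField (IsLocalRing.ResidueField O) →
        Nonempty ((FormalGroup.chainComp φ 0).gr m ≃+ ZMod p))) ∧
    -- (iii)
    (∀ m : ℕ, FormalGroup.chainC p φ (Fin.last n) < m →
      (FormalGroup.chainComp φ 0).cokerFil m = ⊥ ∧
      Subsingleton ((FormalGroup.chainComp φ 0).gr m)) := by
  obtain ⟨s, a, b, h⟩ := FormalGroup.exists_chainProfile hπ hφ hK hcyc
  simp only [h.chainC_eq hπ, Nat.cast_lt, Nat.cast_inj]
  refine ⟨fun i m hm hm' => ?_, fun i => ?_, fun m hm => ?_⟩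
  · obtain ⟨r, hr, rfl, ⟨e⟩⟩ := h.exists_gr_equiv hπ i.castSucc m hm
    rw [h.chainBreak_succ hπ] at hm'
    have hlead := h.leadGroup_of_lt hπ i.castSucc r hr fun i' hi' => by
      obtain rfl := Fin.castSucc_injective _ hi'
      omega
    rw [Fin.val_castSucc] at hlead
    -- The shift between `m` and `r` is a multiple of `p ^ (n - i)`, so the criterion for `r`
    -- becomes one for `m`.
    rw [← Nat.dvd_add_right (h.pow_dvd_chainSum hπ i)] at hlead
    refine ⟨⟨r, by rw [FormalGroup.chainSum_castSucc], ⟨e⟩⟩, fun hnd => ?_, fun hd => ?_⟩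
    · obtain ⟨e'⟩ := FormalGroup.Hom.nonempty_gr_equiv_residueField hπ _ hr (hlead.2 hnd)
      exact ⟨e.trans e'⟩
    · have := FormalGroup.Hom.subsingleton_gr hπ _ hr (hlead.1 hd)
      exact e.toEquiv.subsingleton
  · obtain ⟨r, hr, hm, ⟨e⟩⟩ := h.exists_gr_equiv hπ i.castSucc (FormalGroup.chainBreak φ s i.succ)
      (h.strictMono_chainBreak hπ i.castSucc_lt_succ)
    rw [h.chainBreak_succ hπ] at hm
    -- After the shift, the break of the composite is exactly the first break of the tail.
    obtain rfl : r = p * s i := by omega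
    obtain ⟨e'⟩ := (FormalGroup.chainComp φ i.castSucc).nonempty_gr_equiv hπ hr
    have e'' := e.trans (e'.trans (QuotientAddGroup.quotientAddEquivOfEq (h.leadGroup_mul hπ i)))
    have ha := (h.profile i).residue_lin_ne_zero
    refine ⟨FormalGroup.chainBreak φ s i.succ, p * s i, rfl, ?_, ⟨e⟩, ⟨a i, ?_, ?_⟩,
      fun _ => ?_, fun hk => ?_⟩
    · rw [mul_div_assoc, h.chainT_div hπ, Nat.cast_mul]
    · rw [h.chainT_eq hπ, (h.profile i).linCoeff_eq, mul_comm]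
    · rw [(h.profile i).coeff_eq]
      exact ⟨e''⟩
    · have := FormalGroup.Hom.subsingleton_gr hπ (FormalGroup.chainComp φ i.castSucc) hr
        ((h.leadGroup_mul hπ i).trans (range_addCartierInv_eq_top p ha))
      exact e.toEquiv.subsingleton
    · obtain ⟨ω, hω, h0⟩ := h.exists_zero_addCartierInv hπ i
      obtain ⟨e₃⟩ := nonempty_quotient_range_addCartierInv_equiv p hk
        (h.profile i).residue_top_ne_zero hω h0
      exact ⟨e''.trans e₃⟩
  · have hbot := (FormalGroup.chainComp φ 0).cokerFil_eq_bot
      (h.fil_le_range hπ 0 m (by rwa [FormalGroup.chainSum_zero, zero_add]))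
    exact ⟨hbot, FormalGroup.Hom.subsingleton_gr_of_cokerFil _ hbot⟩
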